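/- Conventions. Lie groups are finite-dimensional real smooth Lie groups (Hausdorff and second countable), vector spaces and Lie algebras are real, and 2-categories and 2-functors are strict. For a category $K$, a category $X$ in $K$ consists of objects $X_0, X_1$ of $K$, morphisms $s,t\colon X_1\to X_0$ and $i\colon X_0\to X_1$, and a composition $\circ\colon X_1\times_{X_0}X_1\to X_1$ satisfying the diagrammatic category laws (the pullback of $t$ along $s$ being required to exist); functors $F=(F_0,F_1)$ in $K$ and natural transformations $\alpha\colon X_0\to X_1'$ in $K$ are defined likewise, and together these form a 2-category $K\mathrm{Cat}$. Let $\mathrm{SLie2Grp}=\mathrm{LieGrp}\,\mathrm{Cat}$; its objects are the strict Lie 2-groups, its morphisms the strict homomorphisms and its 2-morphisms the 2-homomorphisms. A semistrict Lie 2-algebra is a category $L$ in $\mathrm{Vect}$ with a skew-symmetric bilinear functor $[\cdot,\cdot]\colon L\times L\to L$ and a completely antisymmetric trilinear natural isomorphism $J_{x,y,z}\colon [[x,y],z]\to[x,[y,z]]+[[x,z],y]$ (the Jacobiator) satisfying the Jacobiator identity $$J_{[w,x],y,z}\,([J_{w,x,z},y]+1)\,(J_{w,[x,z],y}+J_{[w,z],x,y}+J_{w,x,[y,z]})=[J_{w,x,y},z]\,(J_{[w,y],x,z}+J_{w,[x,y],z})\,([J_{w,y,z},x]+1)\,([w,J_{x,y,z}]+1).$$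 A homomorphism is a linear functor $F$ with a skew-symmetric bilinear natural transformation $F_2(x,y)\colon[F_0x,F_0y]\to F_0[x,y]$ compatible with the Jacobiators, and a 2-homomorphism $\theta\colon F\Rightarrow G$ is a linear natural transformation with $F_2(x,y)\,\theta_{[x,y]}=[\theta_x,\theta_y]\,G_2(x,y)$. (Composites are written in diagrammatic order.) $\mathrm{SLie2Alg}$ is the 2-category of strict Lie 2-algebras (those with $J$ the identity), strict homomorphisms (those with $F_2$ the identity) and all 2-homomorphisms between them. The objects and the morphisms of a strict Lie 2-algebra $\mathfrak c$ form Lie algebras $\mathfrak c_0$ and $\mathfrak c_1$ under the bracket. Proposition. There exists a unique 2-functor $d\colon\mathrm{SLie2Grp}\to\mathrm{SLie2Alg}$ such that: 1. $d$ maps any strict Lie 2-group $C$ to a strict Lie 2-algebra $dC=\mathfrak c$ for which $\mathfrak c_0$ is the Lie algebra of the Lie group of objects $C_0$, $\mathfrak c_1$ is the Lie algebra of the Lie group of morphisms $C_1$, and the maps $s,t\colon\mathfrak c_1\to\mathfrak c_0$, $i\colon\mathfrak c_0\to\mathfrak c_1$ and $\circ\colon\mathfrak c_1\times_{\mathfrak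 c_0}\mathfrak c_1\to\mathfrak c_1$ are the differentials of those for $C$. For $\circ$ this means that the differential of $\circ\colon C_1\times_{C_0}C_1\to C_1$ is the canonical map $\mathrm{Lie}(C_1\times_{C_0}C_1)\to\mathfrak c_1\times_{\mathfrak c_0}\mathfrak c_1$, given by the differentials of the two projections, followed by the composition of $\mathfrak c$. 2. $d$ maps any strict homomorphism $F\colon C\to C'$ to the strict homomorphism $dF\colon\mathfrak c\to\mathfrak c'$ for which $(dF)_0$ is the differential of $F_0$ and $(dF)_1$ is the differential of $F_1$. 3. $d$ maps any 2-homomorphism $\alpha\colon F\Rightarrow G$, where $F,G\colon C\to C'$, to the 2-homomorphism $d\alpha\colon dF\Rightarrow dG$ for which the map $d\alpha\colon\mathfrak c_0\to\mathfrak c_1'$ is the differential of $\alpha\colon C_0\to C_1'$. -/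

import Mathlib

open CategoryTheory CategoryTheory.Limits
open scoped Manifold ContDiff

universe v u

set_option linter.unusedSimpArgs false

/-- A category in `K`.  The pullback `X₁ ×_{X₀} X₁` of `t` along `s`, on which composition is
defined, is required to exist.  The diagrams involving further pullbacks are expressed
with generalized elements `T ⟶ X₁`. -/
structure InternalCat (K : Type u) [Category.{v} K] where
  /-- object of objects -/
  X₀ : K
  /-- object of morphisms -/
  X₁ : K
  /-- source -/
  s : X₁ ⟶ X₀
  /-- target -/
  t : X₁ ⟶ X₀
  /-- identity-assigning morphism -/
  i : X₀ ⟶ X₁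
  hasPullback : HasPullback t s
  /-- composition, in diagrammatic order -/
  c : pullback t s ⟶ X₁
  i_s : i ≫ s = 𝟙 X₀
  i_t : i ≫ t = 𝟙 X₀
  c_s : c ≫ s = pullback.fst t s ≫ s
  c_t : c ≫ t = pullback.snd t s ≫ t
  assoc : ∀ {T : K} (f g h : T ⟶ X₁) (hfg : f ≫ t = g ≫ s) (hgh : g ≫ t = h ≫ s),
    pullback.lift (pullback.lift f g hfg ≫ c) h
        (by rw [Category.assoc, c_t, pullback.lift_snd_assoc, hgh]) ≫ c =
      pullback.lift f (pullback.lift g h hgh ≫ c)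
        (by rw [Category.assoc, c_s, pullback.lift_fst_assoc, hfg]) ≫ c
  id_c : pullback.lift (s ≫ i) (𝟙 X₁)
    (by rw [Category.assoc, i_t, Category.comp_id, Category.id_comp]) ≫ c = 𝟙 X₁
  c_id : pullback.lift (𝟙 X₁) (t ≫ i)
    (by rw [Category.assoc, i_s, Category.comp_id, Category.id_comp]) ≫ c = 𝟙 X₁

namespace InternalCat

variable {K : Type u} [Category.{v} K]

instance (X : InternalCat K) : HasPullback X.t X.s := X.hasPullback

/-- The composite `fg` of two composable generalized elements of `X₁`. -/
noncomputable def cmp (X : InternalCat K) {T : K} (f g : T ⟶ X.X₁) (h : f ≫ X.t = g ≫ X.s) :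
    T ⟶ X.X₁ :=
  pullback.lift f g h ≫ X.c

section lemmas

variable (X : InternalCat K) {T T' : K}

theorem i_s_assoc {Z : K} (k : X.X₀ ⟶ Z) : X.i ≫ X.s ≫ k = k := by
  rw [← Category.assoc, X.i_s, Category.id_comp]

theorem i_t_assoc {Z : K} (k : X.X₀ ⟶ Z) : X.i ≫ X.t ≫ k = k := by
  rw [← Category.assoc, X.i_t, Category.id_comp]

theorem cmp_s (f g : T ⟶ X.X₁) (h : f ≫ X.t = g ≫ X.s) : X.cmp f g h ≫ X.s = f ≫ X.s := by
  rw [cmp, Category.assoc, X.c_s, pullback.lift_fst_assoc]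

theorem cmp_t (f g : T ⟶ X.X₁) (h : f ≫ X.t = g ≫ X.s) : X.cmp f g h ≫ X.t = g ≫ X.t := by
  rw [cmp, Category.assoc, X.c_t, pullback.lift_snd_assoc]

theorem comp_cmp (k : T' ⟶ T) (f g : T ⟶ X.X₁) (h : f ≫ X.t = g ≫ X.s) :
    k ≫ X.cmp f g h = X.cmp (k ≫ f) (k ≫ g) (by simp [h]) := by
  rw [cmp, cmp, ← Category.assoc]
  congr 1
  apply pullback.hom_ext
  · rw [Category.assoc, pullback.lift_fst, pullback.lift_fst]
  · rw [Category.assoc, pullback.lift_snd, pullback.lift_snd]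

theorem cmp_congr {f f' g g' : T ⟶ X.X₁} (hf : f = f') (hg : g = g') (h : f ≫ X.t = g ≫ X.s) :
    X.cmp f g h = X.cmp f' g' (by rw [← hf, ← hg, h]) := by
  subst hf hg; rfl

theorem cmp_assoc (f g h : T ⟶ X.X₁) (hfg : f ≫ X.t = g ≫ X.s) (hgh : g ≫ X.t = h ≫ X.s) :
    X.cmp (X.cmp f g hfg) h (by rw [cmp_t, hgh]) =
      X.cmp f (X.cmp g h hgh) (by rw [cmp_s, hfg]) :=
  X.assoc f g h hfg hgh

theorem id_cmp (k : T ⟶ X.X₀) (f : T ⟶ X.X₁) (h : (k ≫ X.i) ≫ X.t = f ≫ X.s) :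
    X.cmp (k ≫ X.i) f h = f := by
  have hk : k = f ≫ X.s := by rw [← h, Category.assoc, X.i_t, Category.comp_id]
  have := congrArg (f ≫ ·) X.id_c
  simp only [Category.comp_id] at this
  conv_rhs => rw [← this]
  rw [cmp, ← Category.assoc]
  congr 1
  apply pullback.hom_ext
  · rw [pullback.lift_fst, Category.assoc, pullback.lift_fst, hk, Category.assoc]
  · rw [pullback.lift_snd, Category.assoc, pullback.lift_snd, Category.comp_id]

theorem cmp_id (k : T ⟶ X.X₀) (f : T ⟶ X.X₁) (h : f ≫ X.t = (k ≫ X.i) ≫ X.s) :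
    X.cmp f (k ≫ X.i) h = f := by
  have hk : k = f ≫ X.t := by rw [h, Category.assoc, X.i_s, Category.comp_id]
  have := congrArg (f ≫ ·) X.c_id
  simp only [Category.comp_id] at this
  conv_rhs => rw [← this]
  rw [cmp, ← Category.assoc]
  congr 1
  apply pullback.hom_ext
  · rw [pullback.lift_fst, Category.assoc, pullback.lift_fst, Category.comp_id]
  · rw [pullback.lift_snd, Category.assoc, pullback.lift_snd, hk, Category.assoc]

end lemmas

/-- A functor in `K`. -/
@[ext]
structure Func (X Y : InternalCat K) where
  /-- action on objects -/
  F₀ : X.X₀ ⟶ Y.X₀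
  /-- action on morphisms -/
  F₁ : X.X₁ ⟶ Y.X₁
  map_s : F₁ ≫ Y.s = X.s ≫ F₀
  map_t : F₁ ≫ Y.t = X.t ≫ F₀
  map_i : X.i ≫ F₁ = F₀ ≫ Y.i
  map_c : X.c ≫ F₁ = Y.cmp (pullback.fst X.t X.s ≫ F₁) (pullback.snd X.t X.s ≫ F₁)
    (by rw [Category.assoc, Category.assoc, map_t, map_s, pullback.condition_assoc])

namespace Func

theorem map_cmp {X Y : InternalCat K} (F : Func X Y) {T : K} (f g : T ⟶ X.X₁)
    (h : f ≫ X.t = g ≫ X.s) :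
    X.cmp f g h ≫ F.F₁ = Y.cmp (f ≫ F.F₁) (g ≫ F.F₁)
      (by rw [Category.assoc, Category.assoc, F.map_t, F.map_s, reassoc_of% h]) := by
  rw [cmp, Category.assoc, F.map_c, comp_cmp]
  apply cmp_congr
  · rw [pullback.lift_fst_assoc]
  · rw [pullback.lift_snd_assoc]

/-- The identity functor in `K`. -/
def id (X : InternalCat K) : Func X X where
  F₀ := 𝟙 _
  F₁ := 𝟙 _
  map_s := by simp
  map_t := by simp
  map_i := by simp
  map_c := by
    rw [Category.comp_id, cmp_congr X (Category.comp_id _) (Category.comp_id _), cmp]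
    conv_lhs => rw [← Category.id_comp X.c]
    congr 1
    apply pullback.hom_ext <;> simp

/-- Composition of functors in `K`, in diagrammatic order. -/
def comp {X Y Z : InternalCat K} (F : Func X Y) (G : Func Y Z) : Func X Z where
  F₀ := F.F₀ ≫ G.F₀
  F₁ := F.F₁ ≫ G.F₁
  map_s := by rw [Category.assoc, G.map_s, ← Category.assoc, F.map_s, Category.assoc]
  map_t := by rw [Category.assoc, G.map_t, ← Category.assoc, F.map_t, Category.assoc]
  map_i := by rw [← Category.assoc, F.map_i, Category.assoc, G.map_i, Category.assoc]
  map_c := by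
    rw [← Category.assoc, F.map_c, G.map_cmp]
    apply cmp_congr <;> simp

end Func

/-- A natural transformation in `K`. -/
@[ext]
structure NatTrans {X Y : InternalCat K} (F G : Func X Y) where
  /-- the component morphism -/
  app : X.X₀ ⟶ Y.X₁
  app_s : app ≫ Y.s = F.F₀
  app_t : app ≫ Y.t = G.F₀
  naturality : Y.cmp (X.s ≫ app) G.F₁ (by rw [Category.assoc, app_t, G.map_s]) =
    Y.cmp F.F₁ (X.t ≫ app) (by rw [Category.assoc, app_s, F.map_t])

namespace NatTrans

variable {X Y Z : InternalCat K}

theorem naturality_comp {F G : Func X Y} (θ : NatTrans F G) {T : K} (f : T ⟶ X.X₁) :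
    Y.cmp (f ≫ X.s ≫ θ.app) (f ≫ G.F₁)
        (by rw [Category.assoc, Category.assoc, Category.assoc, θ.app_t, G.map_s]) =
      Y.cmp (f ≫ F.F₁) (f ≫ X.t ≫ θ.app)
        (by rw [Category.assoc, Category.assoc, Category.assoc, θ.app_s, F.map_t]) := by
  have := congrArg (f ≫ ·) θ.naturality
  simpa only [comp_cmp] using this

/-- The identity natural transformation. -/
def id (F : Func X Y) : NatTrans F F where
  app := F.F₀ ≫ Y.i
  app_s := by rw [Category.assoc, Y.i_s, Category.comp_id]
  app_t := by rw [Category.assoc, Y.i_t, Category.comp_id]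
  naturality := by
    rw [cmp_congr Y (Category.assoc _ _ _).symm rfl, id_cmp,
      cmp_congr Y rfl (Category.assoc _ _ _).symm, cmp_id]

/-- Vertical composition of natural transformations. -/
noncomputable def vcomp {F G H : Func X Y} (θ : NatTrans F G) (τ : NatTrans G H) :
    NatTrans F H where
  app := Y.cmp θ.app τ.app (by rw [θ.app_t, τ.app_s])
  app_s := by rw [cmp_s, θ.app_s]
  app_t := by rw [cmp_t, τ.app_t]
  naturality := by
    have h1 := θ.naturality
    have h2 := τ.naturality
    rw [cmp_congr Y (comp_cmp _ _ _ _ _) rfl, cmp_assoc, cmp_congr Y rfl h2, ← cmp_assoc,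
      cmp_congr Y h1 rfl, cmp_assoc]
    · exact cmp_congr Y rfl (comp_cmp _ _ _ _ _).symm _
    all_goals simp [θ.app_t, τ.app_t, H.map_s, G.map_s]

/-- Whiskering: the horizontal composite of `1_F` and `θ`. -/
def whiskerLeft (F : Func X Y) {G H : Func Y Z} (θ : NatTrans G H) :
    NatTrans (F.comp G) (F.comp H) where
  app := F.F₀ ≫ θ.app
  app_s := by rw [Category.assoc, θ.app_s]; rfl
  app_t := by rw [Category.assoc, θ.app_t]; rfl
  naturality := by
    have := θ.naturality_comp F.F₁
    refine (cmp_congr Z ?_ rfl _).trans (this.trans (cmp_congr Z rfl ?_ _))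
    · rw [← Category.assoc, ← Category.assoc, F.map_s]
    · rw [← Category.assoc, ← Category.assoc, F.map_t]

/-- Whiskering: the horizontal composite of `θ` and `1_H`. -/
def whiskerRight {F G : Func X Y} (θ : NatTrans F G) (H : Func Y Z) :
    NatTrans (F.comp H) (G.comp H) where
  app := θ.app ≫ H.F₁
  app_s := by rw [Category.assoc, H.map_s, ← Category.assoc, θ.app_s]; rfl
  app_t := by rw [Category.assoc, H.map_t, ← Category.assoc, θ.app_t]; rfl
  naturality := by
    have := congrArg (· ≫ H.F₁) θ.naturality
    simp only [Func.map_cmp] at this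
    refine (cmp_congr Z ?_ rfl _).trans (this.trans (cmp_congr Z rfl ?_ _)) <;>
    rw [Category.assoc]

/-- Equal functors are related by an identity. -/
def ofEq {F G : Func X Y} (h : F = G) : NatTrans F G where
  app := F.F₀ ≫ Y.i
  app_s := by rw [Category.assoc, Y.i_s, Category.comp_id]
  app_t := by rw [Category.assoc, Y.i_t, Category.comp_id, h]
  naturality := by subst h; exact (id F).naturality

end NatTrans

instance : CategoryStruct (InternalCat K) where
  Hom X Y := Func X Y
  id X := Func.id X
  comp F G := F.comp G

noncomputable instance (X Y : InternalCat K) : Category (X ⟶ Y) where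
  Hom F G := NatTrans F G
  id F := NatTrans.id F
  comp θ τ := NatTrans.vcomp θ τ
  id_comp _ := NatTrans.ext (id_cmp Y _ _ _)
  comp_id _ := NatTrans.ext (cmp_id Y _ _ _)
  assoc _ _ _ := NatTrans.ext (cmp_assoc Y _ _ _ _ _)

theorem eqToHom_app {X Y : InternalCat K} {F G : X ⟶ Y} (h : F = G) :
    NatTrans.app (eqToHom h) = F.F₀ ≫ Y.i := by
  subst h; rfl

variable {X Y : InternalCat K}

@[ext]
theorem hom_ext {F G : X ⟶ Y} (h₀ : F.F₀ = G.F₀) (h₁ : F.F₁ = G.F₁) : F = G :=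
  Func.ext h₀ h₁

@[ext]
theorem hom₂_ext {F G : X ⟶ Y} {θ τ : F ⟶ G} (h : θ.app = τ.app) : θ = τ :=
  NatTrans.ext h

theorem id_app (F : X ⟶ Y) : NatTrans.app (𝟙 F) = F.F₀ ≫ Y.i := rfl

theorem vcomp_app {F G H : X ⟶ Y} (θ : F ⟶ G) (τ : G ⟶ H) :
    (θ ≫ τ).app = Y.cmp θ.app τ.app (by rw [θ.app_t, τ.app_s]) := rfl

theorem id_F₀ (X : InternalCat K) : Func.F₀ (𝟙 X) = 𝟙 X.X₀ := rfl
theorem id_F₁ (X : InternalCat K) : Func.F₁ (𝟙 X) = 𝟙 X.X₁ := rfl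
theorem comp_F₀ {X Y Z : InternalCat K} (F : X ⟶ Y) (G : Y ⟶ Z) :
    (F ≫ G).F₀ = F.F₀ ≫ G.F₀ := rfl
theorem comp_F₁ {X Y Z : InternalCat K} (F : X ⟶ Y) (G : Y ⟶ Z) :
    (F ≫ G).F₁ = F.F₁ ≫ G.F₁ := rfl

theorem eqToHom_vcomp_app {F F' G : X ⟶ Y} (h : F = F') (θ : F' ⟶ G) :
    (eqToHom h ≫ θ).app = θ.app := by
  subst h; simp

theorem vcomp_eqToHom_app {F G G' : X ⟶ Y} (h : G = G') (θ : F ⟶ G) :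
    (θ ≫ eqToHom h).app = θ.app := by
  subst h; simp

theorem func_id_comp {X Y : InternalCat K} (F : X ⟶ Y) : 𝟙 X ≫ F = F :=
  Func.ext (Category.id_comp _) (Category.id_comp _)

theorem func_comp_id {X Y : InternalCat K} (F : X ⟶ Y) : F ≫ 𝟙 Y = F :=
  Func.ext (Category.comp_id _) (Category.comp_id _)

theorem func_assoc {X Y Z W : InternalCat K} (F : X ⟶ Y) (G : Y ⟶ Z) (H : Z ⟶ W) :
    (F ≫ G) ≫ H = F ≫ G ≫ H :=
  Func.ext (Category.assoc _ _ _) (Category.assoc _ _ _)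

theorem whiskerLeft_id' {X Y Z : InternalCat K} (F : X ⟶ Y) (G : Y ⟶ Z) :
    NatTrans.whiskerLeft F (𝟙 G) = 𝟙 (F ≫ G) :=
  NatTrans.ext (Category.assoc _ _ _).symm

theorem whiskerRight_id' {X Y Z : InternalCat K} (F : X ⟶ Y) (G : Y ⟶ Z) :
    NatTrans.whiskerRight (𝟙 F) G = 𝟙 (F ≫ G) := by
  refine NatTrans.ext ?_
  change (F.F₀ ≫ Y.i) ≫ G.F₁ = (F.F₀ ≫ G.F₀) ≫ Z.i
  rw [Category.assoc, G.map_i, Category.assoc]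

theorem whiskerLeft_eqToHom {X Y Z : InternalCat K} (F : X ⟶ Y) {G G' : Y ⟶ Z} (h : G = G') :
    NatTrans.whiskerLeft F (eqToHom h) = eqToHom (congrArg (F ≫ ·) h) := by
  subst h; exact whiskerLeft_id' F G

theorem whiskerRight_eqToHom {X Y Z : InternalCat K} {F F' : X ⟶ Y} (h : F = F') (G : Y ⟶ Z) :
    NatTrans.whiskerRight (eqToHom h) G = eqToHom (congrArg (· ≫ G) h) := by
  subst h; exact whiskerRight_id' F G

theorem whisker_exchange' {X Y Z : InternalCat K} {F G : X ⟶ Y} {H I : Y ⟶ Z} (θ : F ⟶ G)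
    (τ : H ⟶ I) :
    CategoryStruct.comp (X := F ≫ H) (Y := F ≫ I) (Z := G ≫ I)
        (NatTrans.whiskerLeft F τ) (NatTrans.whiskerRight θ I) =
      CategoryStruct.comp (X := F ≫ H) (Y := G ≫ H) (Z := G ≫ I)
        (NatTrans.whiskerRight θ H) (NatTrans.whiskerLeft G τ) := by
  refine NatTrans.ext ?_
  have := τ.naturality_comp θ.app
  refine (cmp_congr Z ?_ rfl _).trans (this.trans (cmp_congr Z rfl ?_ _))
  · change F.F₀ ≫ _ = _
    rw [← Category.assoc, θ.app_s]
  · change _ = G.F₀ ≫ _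
    rw [← Category.assoc, θ.app_t]

/-- The 2-category of categories, functors and natural transformations in `K`. -/
noncomputable instance : Bicategory (InternalCat K) where
  whiskerLeft F _ _ θ := NatTrans.whiskerLeft F θ
  whiskerRight θ H := NatTrans.whiskerRight θ H
  associator F G H := eqToIso (func_assoc F G H)
  leftUnitor F := eqToIso (func_id_comp F)
  rightUnitor F := eqToIso (func_comp_id F)
  whiskerLeft_id F G := NatTrans.ext (Category.assoc _ _ _).symm
  whiskerLeft_comp F _ _ _ θ τ := NatTrans.ext (comp_cmp _ _ _ _ _)
  id_whiskerLeft θ := by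
    ext; simp only [eqToIso.hom, eqToIso.inv, eqToHom_vcomp_app, vcomp_eqToHom_app]
    exact Category.id_comp _
  comp_whiskerLeft F G _ _ θ := by
    ext; simp only [eqToIso.hom, eqToIso.inv, eqToHom_vcomp_app, vcomp_eqToHom_app]
    exact Category.assoc _ _ _
  id_whiskerRight F G := whiskerRight_id' F G
  comp_whiskerRight θ τ H := NatTrans.ext (H.map_cmp _ _ _)
  whiskerRight_id θ := by
    ext; simp only [eqToIso.hom, eqToIso.inv, eqToHom_vcomp_app, vcomp_eqToHom_app]
    exact Category.comp_id _
  whiskerRight_comp θ G H := by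
    ext; simp only [eqToIso.hom, eqToIso.inv, eqToHom_vcomp_app, vcomp_eqToHom_app]
    exact (Category.assoc _ _ _).symm
  whisker_assoc F _ _ θ H := by
    ext; simp only [eqToIso.hom, eqToIso.inv, eqToHom_vcomp_app, vcomp_eqToHom_app]
    exact Category.assoc _ _ _
  whisker_exchange θ τ := whisker_exchange' θ τ
  pentagon F G H I := by
    simp only [eqToIso.hom, whiskerRight_eqToHom, whiskerLeft_eqToHom, eqToHom_trans]
  triangle F G := by
    simp only [eqToIso.hom, whiskerRight_eqToHom, whiskerLeft_eqToHom, eqToHom_trans]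

instance : Bicategory.Strict (InternalCat K) where
  id_comp := func_id_comp
  comp_id := func_comp_id
  assoc := func_assoc

end InternalCat

/-- A real Lie group: a finite-dimensional smooth Hausdorff second countable manifold without
boundary which is a group with smooth operations. -/
structure LieGrp : Type (u + 1) where
  carrier : Type u
  /-- model vector space -/
  E : Type u
  [normedAddCommGroup : NormedAddCommGroup E]
  [normedSpace : NormedSpace ℝ E]
  [finiteDimensional : FiniteDimensional ℝ E]
  [topologicalSpace : TopologicalSpace carrier]
  [t2Space : T2Space carrier]
  [secondCountable : SecondCountableTopology carrier]
  [chartedSpace : ChartedSpace E carrier]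
  [group : Group carrier]
  [lieGroup : LieGroup 𝓘(ℝ, E) ∞ carrier]

namespace LieGrp

attribute [instance] normedAddCommGroup normedSpace finiteDimensional topologicalSpace t2Space
  secondCountable chartedSpace group lieGroup

instance : CoeSort LieGrp.{u} (Type u) := ⟨carrier⟩

/-- The category of Lie groups and smooth homomorphisms. -/
instance : Category LieGrp.{u} where
  Hom G H := ContMDiffMonoidMorphism 𝓘(ℝ, G.E) 𝓘(ℝ, H.E) ∞ G H
  id G := { MonoidHom.id G with contMDiff_toFun := contMDiff_id }
  comp f g := { g.toMonoidHom.comp f.toMonoidHom with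
    contMDiff_toFun := g.contMDiff_toFun.comp f.contMDiff_toFun }

instance (G : LieGrp.{u}) : CompleteSpace G.E := FiniteDimensional.complete ℝ G.E

instance (G : LieGrp.{u}) : LieGroup 𝓘(ℝ, G.E) (minSmoothness ℝ 3) G := by
  rw [minSmoothness_of_isRCLikeNormedField]; infer_instance

end LieGrp

/-- A real Lie algebra. -/
structure RealLieAlg : Type (u + 1) where
  carrier : Type u
  [lieRing : LieRing carrier]
  [lieAlgebra : LieAlgebra ℝ carrier]

namespace RealLieAlg

attribute [instance] lieRing lieAlgebra

/-- The underlying vector space. -/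
def toModuleCat (L : RealLieAlg.{u}) : ModuleCat.{u} ℝ := ModuleCat.of ℝ L.carrier

end RealLieAlg

namespace LieGrp

/-- The Lie algebra of a Lie group. -/
noncomputable def lieAlg (G : LieGrp.{u}) : RealLieAlg.{u} where
  carrier := GroupLieAlgebra 𝓘(ℝ, G.E) G

/-- The differential at the identity of a homomorphism of Lie groups. -/
noncomputable def differential {G H : LieGrp.{u}} (f : G ⟶ H) :
    G.lieAlg.toModuleCat ⟶ H.lieAlg.toModuleCat :=
  ModuleCat.ofHom (X := GroupLieAlgebra 𝓘(ℝ, G.E) G) (Y := GroupLieAlgebra 𝓘(ℝ, H.E) H)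
    (mfderiv 𝓘(ℝ, G.E) 𝓘(ℝ, H.E) f.toFun 1).toLinearMap

theorem differential_comp {G H K : LieGrp.{u}} (f : G ⟶ H) (g : H ⟶ K) :
    differential (f ≫ g) = differential f ≫ differential g := by
  have hf : MDifferentiableAt 𝓘(ℝ, G.E) 𝓘(ℝ, H.E) f.toFun 1 :=
    f.contMDiff_toFun.mdifferentiable (by simp) 1
  have hg : MDifferentiableAt 𝓘(ℝ, H.E) 𝓘(ℝ, K.E) g.toFun (f.toFun 1) :=
    g.contMDiff_toFun.mdifferentiable (by simp) _
  have h1 : f.toFun 1 = 1 := f.toMonoidHom.map_one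
  have h := mfderiv_comp (1 : G) hg hf
  rw [h1] at h
  ext v
  exact DFunLike.congr_fun h v

end LieGrp

/-- A real 2-vector space. -/
abbrev TwoVect := InternalCat (ModuleCat.{u} ℝ)

namespace TwoVect

variable (V W : TwoVect.{u})

/-- The source of a morphism. -/
def src : V.X₁ →ₗ[ℝ] V.X₀ := V.s.hom

/-- The target of a morphism. -/
def tgt : V.X₁ →ₗ[ℝ] V.X₀ := V.t.hom

/-- The identity morphism of an object. -/
def one : V.X₀ →ₗ[ℝ] V.X₁ := V.i.hom

/-- The arrow part of a morphism. -/
def arrow (f : V.X₁) : V.X₁ := f - V.one (V.src f)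

/-- The space of composable pairs of morphisms. -/
def pairs : Submodule ℝ (V.X₁ × V.X₁) :=
  LinearMap.eqLocus (V.tgt ∘ₗ LinearMap.fst ℝ _ _) (V.src ∘ₗ LinearMap.snd ℝ _ _)

/-- Composition, as a linear map on the space of composable pairs of morphisms. -/
noncomputable def pairsComp : V.pairs →ₗ[ℝ] V.X₁ :=
  (V.cmp (ModuleCat.ofHom (LinearMap.fst ℝ _ _ ∘ₗ V.pairs.subtype))
    (ModuleCat.ofHom (LinearMap.snd ℝ _ _ ∘ₗ V.pairs.subtype))
    (by ext p; exact p.2)).hom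

/-- The composite `fg` of `f : x ⟶ y` and `g : y ⟶ z`. -/
noncomputable def comp (f g : V.X₁) (h : V.tgt f = V.src g) : V.X₁ :=
  V.pairsComp ⟨(f, g), h⟩

/-- `f` has a two-sided inverse. -/
def IsInvertible (f : V.X₁) : Prop :=
  ∃ (g : V.X₁) (h : V.tgt f = V.src g) (h' : V.tgt g = V.src f),
    V.comp f g h = V.one (V.src f) ∧ V.comp g f h' = V.one (V.tgt f)

variable {V W}

@[simp] theorem src_one (x : V.X₀) : V.src (V.one x) = x :=
  LinearMap.congr_fun (congrArg ModuleCat.Hom.hom V.i_s) x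

@[simp] theorem tgt_one (x : V.X₀) : V.tgt (V.one x) = x :=
  LinearMap.congr_fun (congrArg ModuleCat.Hom.hom V.i_t) x

/-- Composites of generalized elements, evaluated at an element. -/
theorem cmp_apply {T : ModuleCat.{u} ℝ} (f g : T ⟶ V.X₁) (h : f ≫ V.t = g ≫ V.s) (x : T) :
    (V.cmp f g h).hom x = V.comp (f.hom x) (g.hom x)
      (LinearMap.congr_fun (congrArg ModuleCat.Hom.hom h) x) := by
  let k : T ⟶ ModuleCat.of ℝ V.pairs := ModuleCat.ofHom
    ((f.hom.prod g.hom).codRestrict V.pairs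
      fun x => LinearMap.congr_fun (congrArg ModuleCat.Hom.hom h) x)
  have := V.comp_cmp k (ModuleCat.ofHom (LinearMap.fst ℝ _ _ ∘ₗ V.pairs.subtype))
    (ModuleCat.ofHom (LinearMap.snd ℝ _ _ ∘ₗ V.pairs.subtype)) (by ext p; exact p.2)
  exact (LinearMap.congr_fun (congrArg ModuleCat.Hom.hom this) x).symm

@[simp] theorem src_comp (f g : V.X₁) (h : V.tgt f = V.src g) :
    V.src (V.comp f g h) = V.src f := by
  have := congrArg ModuleCat.Hom.hom (V.cmp_s
    (ModuleCat.ofHom (LinearMap.fst ℝ _ _ ∘ₗ V.pairs.subtype))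
    (ModuleCat.ofHom (LinearMap.snd ℝ _ _ ∘ₗ V.pairs.subtype)) (by ext p; exact p.2))
  exact LinearMap.congr_fun this ⟨(f, g), h⟩

@[simp] theorem tgt_comp (f g : V.X₁) (h : V.tgt f = V.src g) :
    V.tgt (V.comp f g h) = V.tgt g := by
  have := congrArg ModuleCat.Hom.hom (V.cmp_t
    (ModuleCat.ofHom (LinearMap.fst ℝ _ _ ∘ₗ V.pairs.subtype))
    (ModuleCat.ofHom (LinearMap.snd ℝ _ _ ∘ₗ V.pairs.subtype)) (by ext p; exact p.2))
  exact LinearMap.congr_fun this ⟨(f, g), h⟩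

theorem comp_congr {f f' g g' : V.X₁} (hf : f = f') (hg : g = g') (h : V.tgt f = V.src g) :
    V.comp f g h = V.comp f' g' (by rw [← hf, ← hg, h]) := by
  subst hf hg; rfl

@[simp] theorem one_comp (x : V.X₀) (f : V.X₁) (h : V.tgt (V.one x) = V.src f) :
    V.comp (V.one x) f h = f := by
  have hx : x = V.src f := by rw [← h, tgt_one]
  subst hx
  exact (cmp_apply (V.s ≫ V.i) (𝟙 _) (by rw [Category.assoc, V.i_t]; simp) f).symm.trans
    (LinearMap.congr_fun (congrArg ModuleCat.Hom.hom V.id_c) f)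

@[simp] theorem comp_one (x : V.X₀) (f : V.X₁) (h : V.tgt f = V.src (V.one x)) :
    V.comp f (V.one x) h = f := by
  have hx : x = V.tgt f := by rw [h, src_one]
  subst hx
  exact (cmp_apply (𝟙 _) (V.t ≫ V.i) (by rw [Category.assoc, V.i_s]; simp) f).symm.trans
    (LinearMap.congr_fun (congrArg ModuleCat.Hom.hom V.c_id) f)

/-- The map on objects of a linear functor. -/
def obj (F : V ⟶ W) : V.X₀ →ₗ[ℝ] W.X₀ := F.F₀.hom

/-- The map on morphisms of a linear functor. -/
def mor (F : V ⟶ W) : V.X₁ →ₗ[ℝ] W.X₁ := F.F₁.hom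

@[simp] theorem src_mor (F : V ⟶ W) (f : V.X₁) : W.src (mor F f) = obj F (V.src f) :=
  LinearMap.congr_fun (congrArg ModuleCat.Hom.hom F.map_s) f

@[simp] theorem tgt_mor (F : V ⟶ W) (f : V.X₁) : W.tgt (mor F f) = obj F (V.tgt f) :=
  LinearMap.congr_fun (congrArg ModuleCat.Hom.hom F.map_t) f

@[simp] theorem mor_one (F : V ⟶ W) (x : V.X₀) : mor F (V.one x) = W.one (obj F x) :=
  LinearMap.congr_fun (congrArg ModuleCat.Hom.hom F.map_i) x

/-- The component of a linear natural transformation at an object. -/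
def app {F G : V ⟶ W} (θ : F ⟶ G) : V.X₀ →ₗ[ℝ] W.X₁ := θ.app.hom

@[simp] theorem src_app {F G : V ⟶ W} (θ : F ⟶ G) (x : V.X₀) : W.src (app θ x) = obj F x :=
  LinearMap.congr_fun (congrArg ModuleCat.Hom.hom θ.app_s) x

@[simp] theorem tgt_app {F G : V ⟶ W} (θ : F ⟶ G) (x : V.X₀) : W.tgt (app θ x) = obj G x :=
  LinearMap.congr_fun (congrArg ModuleCat.Hom.hom θ.app_t) x

end TwoVect

open TwoVect in
/-- A semistrict Lie 2-algebra over `ℝ`. -/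
structure Lie2Alg : Type (u + 1) where
  /-- the underlying 2-vector space -/
  V : TwoVect.{u}
  /-- the bracket of objects -/
  br₀ : V.X₀ →ₗ[ℝ] V.X₀ →ₗ[ℝ] V.X₀
  /-- the bracket of morphisms -/
  br₁ : V.X₁ →ₗ[ℝ] V.X₁ →ₗ[ℝ] V.X₁
  src_br : ∀ f g, V.src (br₁ f g) = br₀ (V.src f) (V.src g)
  tgt_br : ∀ f g, V.tgt (br₁ f g) = br₀ (V.tgt f) (V.tgt g)
  br_one : ∀ x y, br₁ (V.one x) (V.one y) = V.one (br₀ x y)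
  br_comp : ∀ (f f' g g' : V.X₁) (h : V.tgt f = V.src f') (h' : V.tgt g = V.src g'),
    br₁ (V.comp f f' h) (V.comp g g' h') =
      V.comp (br₁ f g) (br₁ f' g') (by rw [tgt_br, src_br, h, h'])
  br₀_skew : ∀ x y, br₀ x y = -br₀ y x
  br₁_skew : ∀ f g, br₁ f g = -br₁ g f
  /-- the Jacobiator, which is trilinear -/
  J : V.X₀ →ₗ[ℝ] V.X₀ →ₗ[ℝ] V.X₀ →ₗ[ℝ] V.X₁
  src_J : ∀ x y z, V.src (J x y z) = br₀ (br₀ x y) z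
  tgt_J : ∀ x y z, V.tgt (J x y z) = br₀ x (br₀ y z) + br₀ (br₀ x z) y
  J_natural : ∀ f g h : V.X₁,
    V.comp (br₁ (br₁ f g) h) (J (V.tgt f) (V.tgt g) (V.tgt h))
        (by simp only [tgt_br, src_J]) =
      V.comp (J (V.src f) (V.src g) (V.src h)) (br₁ f (br₁ g h) + br₁ (br₁ f h) g)
        (by simp only [tgt_J, map_add, src_br])
  J_invertible : ∀ x y z, V.IsInvertible (J x y z)
  J_antisymm₁₂ : ∀ x y z, V.arrow (J x y z) = -V.arrow (J y x z)
  J_antisymm₂₃ : ∀ x y z, V.arrow (J x y z) = -V.arrow (J x z y)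
  /-- the Jacobiator identity -/
  jacobiator_identity : ∀ w x y z : V.X₀,
    V.comp
        (V.comp (J (br₀ w x) y z)
          (br₁ (J w x z) (V.one y) + V.one (br₀ (br₀ w x) (br₀ y z)))
          (by simp only [map_add, LinearMap.add_apply, tgt_comp, src_br, tgt_br,
            src_J, tgt_J, src_one, tgt_one]; abel))
        (J w (br₀ x z) y + J (br₀ w z) x y + J w x (br₀ y z))
        (by simp only [map_add, LinearMap.add_apply, tgt_comp, src_br, tgt_br,
            src_J, tgt_J, src_one, tgt_one]) =
      V.comp
        (V.comp
          (V.comp (br₁ (J w x y) (V.one z))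
            (J (br₀ w y) x z + J w (br₀ x y) z)
            (by simp only [map_add, LinearMap.add_apply, tgt_comp, src_br, tgt_br,
            src_J, tgt_J, src_one, tgt_one]; abel))
          (br₁ (J w y z) (V.one x) +
            V.one (br₀ (br₀ w y) (br₀ x z) + br₀ w (br₀ (br₀ x y) z) + br₀ (br₀ w z) (br₀ x y)))
          (by simp only [map_add, LinearMap.add_apply, tgt_comp, src_br, tgt_br,
            src_J, tgt_J, src_one, tgt_one]; abel))
        (br₁ (V.one w) (J x y z) +
          V.one (br₀ (br₀ w y) (br₀ x z) + br₀ (br₀ w z) (br₀ x y) +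
            br₀ (br₀ w (br₀ y z)) x + br₀ (br₀ (br₀ w z) y) x))
        (by simp only [map_add, LinearMap.add_apply, tgt_comp, src_br, tgt_br,
            src_J, tgt_J, src_one, tgt_one]; abel)

namespace Lie2Alg

open TwoVect

/-- A homomorphism of Lie 2-algebras. -/
structure Hom (L L' : Lie2Alg.{u}) where
  /-- the underlying linear functor -/
  F : L.V ⟶ L'.V
  /-- the skew-symmetric bilinear natural transformation `[F₀ x, F₀ y] ⟶ F₀ [x, y]` -/
  F₂ : L.V.X₀ →ₗ[ℝ] L.V.X₀ →ₗ[ℝ] L'.V.X₁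
  src_F₂ : ∀ x y, L'.V.src (F₂ x y) = L'.br₀ (obj F x) (obj F y)
  tgt_F₂ : ∀ x y, L'.V.tgt (F₂ x y) = obj F (L.br₀ x y)
  F₂_natural : ∀ f g : L.V.X₁,
    L'.V.comp (L'.br₁ (mor F f) (mor F g)) (F₂ (L.V.tgt f) (L.V.tgt g))
        (by simp only [L'.tgt_br, src_F₂, tgt_mor]) =
      L'.V.comp (F₂ (L.V.src f) (L.V.src g)) (mor F (L.br₁ f g))
        (by simp only [L.src_br, tgt_F₂, src_mor])
  F₂_skew : ∀ x y, F₂ x y = -F₂ y x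
  coherence : ∀ x y z : L.V.X₀,
    L'.V.comp
        (L'.V.comp (L'.J (obj F x) (obj F y) (obj F z))
          (L'.br₁ (L'.V.one (obj F x)) (F₂ y z) + L'.br₁ (F₂ x z) (L'.V.one (obj F y)))
          (by simp only [map_add, L'.src_br, L'.tgt_J, src_one, src_F₂]))
        (F₂ x (L.br₀ y z) + F₂ (L.br₀ x z) y)
        (by simp only [map_add, L'.tgt_br, tgt_comp, tgt_one, src_F₂, tgt_F₂]) =
      L'.V.comp
        (L'.V.comp (L'.br₁ (F₂ x y) (L'.V.one (obj F z))) (F₂ (L.br₀ x y) z)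
          (by simp only [L'.tgt_br, tgt_one, src_F₂, tgt_F₂]))
        (mor F (L.J x y z))
        (by simp only [tgt_comp, src_mor, L.src_J, tgt_F₂])

/-- A 2-homomorphism between homomorphisms of Lie 2-algebras. -/
@[ext]
structure TwoHom {L L' : Lie2Alg.{u}} (F G : Hom L L') where
  /-- the underlying linear natural transformation -/
  θ : F.F ⟶ G.F
  square : ∀ x y : L.V.X₀,
    L'.V.comp (F.F₂ x y) (app θ (L.br₀ x y)) (by rw [F.tgt_F₂, src_app]) =
      L'.V.comp (L'.br₁ (app θ x) (app θ y)) (G.F₂ x y)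
        (by rw [G.src_F₂, L'.tgt_br, tgt_app, tgt_app])

/-- A Lie 2-algebra is strict if its Jacobiator is the identity. -/
def IsStrict (L : Lie2Alg.{u}) : Prop :=
  ∀ x y z, L.J x y z = L.V.one (L.br₀ (L.br₀ x y) z)

/-- A homomorphism `F` of Lie 2-algebras is strict if `F₂` is the identity. -/
def Hom.IsStrict {L L' : Lie2Alg.{u}} (F : Hom L L') : Prop :=
  ∀ x y, F.F₂ x y = L'.V.one (L'.br₀ (obj F.F x) (obj F.F y))

theorem IsStrict.jacobi₀ {L : Lie2Alg.{u}} (hL : L.IsStrict) (x y z : L.V.X₀) :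
    L.br₀ (L.br₀ x y) z = L.br₀ x (L.br₀ y z) + L.br₀ (L.br₀ x z) y := by
  rw [← L.tgt_J, hL, tgt_one]

theorem IsStrict.jacobi₁ {L : Lie2Alg.{u}} (hL : L.IsStrict) (f g h : L.V.X₁) :
    L.br₁ (L.br₁ f g) h = L.br₁ f (L.br₁ g h) + L.br₁ (L.br₁ f h) g := by
  have := L.J_natural f g h
  simpa only [hL _ _ _, one_comp, comp_one] using this

/-- The Lie algebra given by a skew-symmetric bracket satisfying the Jacobi identity. -/
def lieOfBracket (M : ModuleCat.{u} ℝ) (b : M →ₗ[ℝ] M →ₗ[ℝ] M) (skew : ∀ x y, b x y = -b y x)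
    (jacobi : ∀ x y z, b (b x y) z = b x (b y z) + b (b x z) y) : RealLieAlg.{u} :=
  letI : LieRing M :=
    { M.isAddCommGroup with
      bracket := fun x y => b x y
      add_lie := fun x y z => by change b (x + y) z = b x z + b y z; simp
      lie_add := fun x y z => (b x).map_add y z
      lie_self := fun x => by
        have h : (2 : ℝ) • b x x = 0 := by rw [two_smul, add_eq_zero_iff_eq_neg]; exact skew x x
        exact (smul_eq_zero.mp h).resolve_left two_ne_zero
      leibniz_lie := fun x y z => by
        change b x (b y z) = b (b x y) z + b y (b x z)
        rw [jacobi x y z, skew (b x z) y]; simp }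
  letI : LieAlgebra ℝ M := { M.isModule with lie_smul := fun c x y => (b x).map_smul c y }
  { carrier := M }

namespace Hom

variable {L L' L'' : Lie2Alg.{u}}

@[ext]
theorem ext' {F G : Hom L L'} (h : F.F = G.F) (h₂ : F.F₂ = G.F₂) : F = G := by
  cases F; cases G; cases h; cases h₂; rfl

theorem IsStrict.obj_br {F : Hom L L'} (hF : F.IsStrict) (x y : L.V.X₀) :
    obj F.F (L.br₀ x y) = L'.br₀ (obj F.F x) (obj F.F y) := by
  rw [← F.tgt_F₂, hF, tgt_one]

theorem IsStrict.mor_br {F : Hom L L'} (hF : F.IsStrict) (f g : L.V.X₁) :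
    mor F.F (L.br₁ f g) = L'.br₁ (mor F.F f) (mor F.F g) := by
  have := F.F₂_natural f g
  simpa only [hF _ _, one_comp, comp_one] using this.symm

/-- A linear functor between strict Lie 2-algebras that preserves brackets is a homomorphism
with identity `F₂`. -/
def ofStrict (hL : L.IsStrict) (hL' : L'.IsStrict) (F : L.V ⟶ L'.V)
    (h₀ : ∀ x y, obj F (L.br₀ x y) = L'.br₀ (obj F x) (obj F y))
    (h₁ : ∀ f g, mor F (L.br₁ f g) = L'.br₁ (mor F f) (mor F g)) : Hom L L' where
  F := F
  F₂ := (L'.br₀.compl₁₂ (obj F) (obj F)).compr₂ L'.V.one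
  src_F₂ x y := src_one _
  tgt_F₂ x y := by rw [h₀]; exact tgt_one _
  F₂_natural f g := by
    simp only [LinearMap.compr₂_apply, LinearMap.compl₁₂_apply, one_comp, comp_one, h₁]
  F₂_skew x y := by
    simp only [LinearMap.compr₂_apply, LinearMap.compl₁₂_apply]
    rw [L'.br₀_skew, map_neg]
  coherence x y z := by
    simp only [LinearMap.compr₂_apply, LinearMap.compl₁₂_apply, hL _ _ _, hL' _ _ _, h₀,
      L'.br_one, ← map_add, mor_one, one_comp, comp_one]
end Hom

end Lie2Alg

/-- A strict Lie 2-algebra. -/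
structure SLie2Alg : Type (u + 1) where
  /-- the underlying semistrict Lie 2-algebra -/
  toLie2Alg : Lie2Alg.{u}
  strict : toLie2Alg.IsStrict

namespace SLie2Alg

open TwoVect

/-- The underlying 2-vector space. -/
abbrev V (L : SLie2Alg.{u}) : TwoVect.{u} := L.toLie2Alg.V

/-- The Lie algebra of objects. -/
def lie₀ (L : SLie2Alg.{u}) : RealLieAlg.{u} :=
  Lie2Alg.lieOfBracket L.V.X₀ L.toLie2Alg.br₀ L.toLie2Alg.br₀_skew L.strict.jacobi₀

/-- The Lie algebra of morphisms. -/
def lie₁ (L : SLie2Alg.{u}) : RealLieAlg.{u} :=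
  Lie2Alg.lieOfBracket L.V.X₁ L.toLie2Alg.br₁ L.toLie2Alg.br₁_skew L.strict.jacobi₁

theorem toModuleCat_lie₀ (L : SLie2Alg.{u}) : L.lie₀.toModuleCat = L.V.X₀ := rfl

theorem toModuleCat_lie₁ (L : SLie2Alg.{u}) : L.lie₁.toModuleCat = L.V.X₁ := rfl

/-- A strict homomorphism of strict Lie 2-algebras. -/
structure Hom (L L' : SLie2Alg.{u}) where
  /-- the underlying homomorphism of semistrict Lie 2-algebras -/
  toHom : Lie2Alg.Hom L.toLie2Alg L'.toLie2Alg
  strict : toHom.IsStrict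

/-- The underlying linear functor. -/
abbrev Hom.F {L L' : SLie2Alg.{u}} (f : Hom L L') : L.V ⟶ L'.V := f.toHom.F

theorem Hom.ext_F {L L' : SLie2Alg.{u}} {f g : Hom L L'} (h : f.F = g.F) : f = g := by
  obtain ⟨f, hf⟩ := f
  obtain ⟨g, hg⟩ := g
  have : f = g := Lie2Alg.Hom.ext' h (by
    ext x y
    rw [hf, hg]
    change f.F = g.F at h
    rw [h])
  subst this; rfl

/-- A linear functor preserving brackets, as a strict homomorphism. -/
def Hom.mk' {L L' : SLie2Alg.{u}} (F : L.V ⟶ L'.V)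
    (h₀ : ∀ x y, obj F (L.toLie2Alg.br₀ x y) = L'.toLie2Alg.br₀ (obj F x) (obj F y))
    (h₁ : ∀ f g, mor F (L.toLie2Alg.br₁ f g) = L'.toLie2Alg.br₁ (mor F f) (mor F g)) :
    Hom L L' where
  toHom := Lie2Alg.Hom.ofStrict L.strict L'.strict F h₀ h₁
  strict _ _ := rfl

/-- Strict homomorphisms are composed by composing the underlying linear functors. -/
instance : CategoryStruct SLie2Alg.{u} where
  Hom L L' := Hom L L'
  id L := Hom.mk' (𝟙 L.V) (fun _ _ => rfl) (fun _ _ => rfl)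
  comp f g := Hom.mk' (f.F ≫ g.F)
    (fun x y => (congrArg (obj g.F) (f.strict.obj_br x y)).trans (g.strict.obj_br _ _))
    (fun x y => (congrArg (mor g.F) (f.strict.mor_br x y)).trans (g.strict.mor_br _ _))

variable {L L' L'' : SLie2Alg.{u}}

/-- The composite of strict homomorphisms agrees with the composite of homomorphisms of
semistrict Lie 2-algebras: `(fg)₂` is `g₂` followed by the image of `f₂` under `g`. -/
theorem comp_F₂ (f : L ⟶ L') (g : L' ⟶ L'') (x y : L.V.X₀) :
    (f ≫ g).toHom.F₂ x y =
      L''.V.comp (g.toHom.F₂ (obj f.F x) (obj f.F y)) (mor g.F (f.toHom.F₂ x y))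
        (by rw [g.toHom.tgt_F₂, src_mor, f.toHom.src_F₂]) := by
  simp only [g.strict _ _, one_comp, f.strict _ _, mor_one]
  exact congrArg L''.V.one (g.strict.obj_br _ _).symm

/-- Between strict homomorphisms, a linear natural transformation is a 2-homomorphism if and
only if it preserves brackets. -/
theorem square_iff {f g : L ⟶ L'} (θ : f.F ⟶ g.F) (x y : L.V.X₀) :
    L'.V.comp (f.toHom.F₂ x y) (app θ (L.toLie2Alg.br₀ x y))
        (by rw [f.toHom.tgt_F₂, src_app]) =
      L'.V.comp (L'.toLie2Alg.br₁ (app θ x) (app θ y)) (g.toHom.F₂ x y)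
        (by rw [g.toHom.src_F₂, L'.toLie2Alg.tgt_br, tgt_app, tgt_app]) ↔
    app θ (L.toLie2Alg.br₀ x y) = L'.toLie2Alg.br₁ (app θ x) (app θ y) := by
  simp only [f.strict _ _, g.strict _ _, one_comp, comp_one]

/-- A linear natural transformation preserving brackets, as a 2-homomorphism. -/
def mkTwoHom {f g : L ⟶ L'} (θ : f.F ⟶ g.F)
    (h : ∀ x y, app θ (L.toLie2Alg.br₀ x y) = L'.toLie2Alg.br₁ (app θ x) (app θ y)) :
    Lie2Alg.TwoHom f.toHom g.toHom :=
  ⟨θ, fun x y => (square_iff θ x y).2 (h x y)⟩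

theorem app_br {f g : L ⟶ L'} (θ : Lie2Alg.TwoHom f.toHom g.toHom) (x y : L.V.X₀) :
    app θ.θ (L.toLie2Alg.br₀ x y) = L'.toLie2Alg.br₁ (app θ.θ x) (app θ.θ y) :=
  (square_iff (f := f) (g := g) θ.θ x y).1 (θ.square x y)

theorem app_vcomp {f g h : L.V ⟶ L'.V} (θ : f ⟶ g) (τ : g ⟶ h) (x : L.V.X₀) :
    app (θ ≫ τ) x = L'.V.comp (app θ x) (app τ x) (by rw [tgt_app, src_app]) :=
  cmp_apply _ _ _ x

/-- 2-homomorphisms are composed vertically as natural transformations. -/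
noncomputable instance (L L' : SLie2Alg.{u}) : Category (L ⟶ L') where
  Hom f g := Lie2Alg.TwoHom f.toHom g.toHom
  id f := mkTwoHom (𝟙 f.F) fun x y => by
    change L'.V.one (obj f.F _) = L'.toLie2Alg.br₁ (L'.V.one (obj f.F x)) (L'.V.one (obj f.F y))
    rw [L'.toLie2Alg.br_one, f.strict.obj_br]
  comp {f g h} θ τ := mkTwoHom (θ.θ ≫ τ.θ) fun x y => by
    simp only [app_vcomp, L'.toLie2Alg.br_comp]
    exact comp_congr (app_br (f := f) (g := g) θ x y) (app_br (f := g) (g := h) τ x y) _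
  id_comp θ := Lie2Alg.TwoHom.ext (Category.id_comp θ.θ)
  comp_id θ := Lie2Alg.TwoHom.ext (Category.comp_id θ.θ)
  assoc θ τ σ := Lie2Alg.TwoHom.ext (Category.assoc θ.θ τ.θ σ.θ)

theorem eqToHom_θ {f g : L ⟶ L'} (h : f = g) :
    Lie2Alg.TwoHom.θ (eqToHom h : f ⟶ g) = eqToHom (congrArg Hom.F h) := by
  subst h; rfl

/-- The linear functor underlying a strict homomorphism. -/
abbrev functor (f : L ⟶ L') : L.V ⟶ L'.V := Hom.F f

/-- The natural transformation underlying a 2-homomorphism. -/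
abbrev nat {f g : L ⟶ L'} (θ : f ⟶ g) : f.F ⟶ g.F := Lie2Alg.TwoHom.θ θ

theorem hom₂_ext {f g : L ⟶ L'} {θ τ : f ⟶ g} (h : nat θ = nat τ) : θ = τ :=
  Lie2Alg.TwoHom.ext h

theorem vcomp_θ {f g h : L ⟶ L'} (θ : f ⟶ g) (τ : g ⟶ h) : (θ ≫ τ).θ = θ.θ ≫ τ.θ := rfl

open Bicategory

theorem hom_id_comp (f : L ⟶ L') : 𝟙 L ≫ f = f :=
  Hom.ext_F (InternalCat.func_id_comp f.F)

theorem hom_comp_id (f : L ⟶ L') : f ≫ 𝟙 L' = f :=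
  Hom.ext_F (InternalCat.func_comp_id f.F)

theorem hom_assoc {L''' : SLie2Alg.{u}} (f : L ⟶ L') (g : L' ⟶ L'') (h : L'' ⟶ L''') :
    (f ≫ g) ≫ h = f ≫ g ≫ h :=
  Hom.ext_F (InternalCat.func_assoc f.F g.F h.F)

/-- Whiskering of 2-homomorphisms, as for natural transformations. -/
noncomputable def whiskerLeft (f : L ⟶ L') {g h : L' ⟶ L''} (θ : g ⟶ h) : f ≫ g ⟶ f ≫ h :=
  mkTwoHom (f := f ≫ g) (g := f ≫ h) (f.F ◁ θ.θ) fun x y =>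
    (congrArg (app θ.θ) (f.strict.obj_br x y)).trans (app_br (f := g) (g := h) θ _ _)

/-- Whiskering of 2-homomorphisms, as for natural transformations. -/
noncomputable def whiskerRight {f g : L ⟶ L'} (θ : f ⟶ g) (h : L' ⟶ L'') : f ≫ h ⟶ g ≫ h :=
  mkTwoHom (f := f ≫ h) (g := g ≫ h) (θ.θ ▷ h.F) fun x y =>
    (congrArg (mor h.F) (app_br (f := f) (g := g) θ x y)).trans (h.strict.mor_br _ _)

theorem whiskerLeft_eqToHom (f : L ⟶ L') {g h : L' ⟶ L''} (e : g = h) :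
    whiskerLeft f (eqToHom e) = eqToHom (congrArg (f ≫ ·) e) := by
  subst e
  exact Lie2Alg.TwoHom.ext (Bicategory.whiskerLeft_id f.F g.F)

theorem whiskerRight_eqToHom {f g : L ⟶ L'} (e : f = g) (h : L' ⟶ L'') :
    whiskerRight (eqToHom e) h = eqToHom (congrArg (· ≫ h) e) := by
  subst e
  exact Lie2Alg.TwoHom.ext (Bicategory.id_whiskerRight f.F h.F)

/-- The 2-category of strict Lie 2-algebras, strict homomorphisms and 2-homomorphisms. -/
noncomputable instance : Bicategory SLie2Alg.{u} where
  whiskerLeft f _ _ θ := whiskerLeft f θ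
  whiskerRight θ h := whiskerRight θ h
  associator f g h := eqToIso (hom_assoc f g h)
  leftUnitor f := eqToIso (hom_id_comp f)
  rightUnitor f := eqToIso (hom_comp_id f)
  whiskerLeft_id f g := hom₂_ext (Bicategory.whiskerLeft_id f.F g.F)
  whiskerLeft_comp f _ _ _ θ τ := hom₂_ext (Bicategory.whiskerLeft_comp f.F (nat θ) (nat τ))
  id_whiskerLeft θ := by
    refine hom₂_ext ?_
    simp only [eqToIso.hom, eqToIso.inv, nat, vcomp_θ, eqToHom_θ]
    exact Bicategory.id_whiskerLeft (nat θ)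
  comp_whiskerLeft f g _ _ θ := by
    refine hom₂_ext ?_
    simp only [eqToIso.hom, eqToIso.inv, nat, vcomp_θ, eqToHom_θ]
    exact Bicategory.comp_whiskerLeft f.F g.F (nat θ)
  id_whiskerRight f g := hom₂_ext (Bicategory.id_whiskerRight f.F g.F)
  comp_whiskerRight θ τ h := hom₂_ext (Bicategory.comp_whiskerRight (nat θ) (nat τ) h.F)
  whiskerRight_id θ := by
    refine hom₂_ext ?_
    simp only [eqToIso.hom, eqToIso.inv, nat, vcomp_θ, eqToHom_θ]
    exact Bicategory.whiskerRight_id (nat θ)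
  whiskerRight_comp θ g h := by
    refine hom₂_ext ?_
    simp only [eqToIso.hom, eqToIso.inv, nat, vcomp_θ, eqToHom_θ]
    exact Bicategory.whiskerRight_comp (nat θ) g.F h.F
  whisker_assoc f _ _ θ h := by
    refine hom₂_ext ?_
    simp only [eqToIso.hom, eqToIso.inv, nat, vcomp_θ, eqToHom_θ]
    exact Bicategory.whisker_assoc f.F (nat θ) h.F
  whisker_exchange θ τ := hom₂_ext (Bicategory.whisker_exchange (nat θ) (nat τ))
  pentagon f g h k := by
    simp only [eqToIso.hom, whiskerRight_eqToHom, whiskerLeft_eqToHom, eqToHom_trans]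
  triangle f g := by
    simp only [eqToIso.hom, whiskerRight_eqToHom, whiskerLeft_eqToHom, eqToHom_trans]

instance : Bicategory.Strict SLie2Alg.{u} where
  id_comp := hom_id_comp
  comp_id := hom_comp_id
  assoc := hom_assoc

end SLie2Alg

/-- The 2-category of strict Lie 2-groups: categories, functors and natural transformations in
the category of Lie groups. -/
abbrev SLie2Grp : Type (u + 1) := InternalCat LieGrp.{u}

open LieGrp

/-- The Lie algebras of objects and of morphisms of `c` are the Lie algebras of the Lie groups of
objects and of morphisms of `C`. -/
structure HasLieAlgebras (C : SLie2Grp.{u}) (c : SLie2Alg.{u}) : Prop where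
  lie₀_eq : c.lie₀ = C.X₀.lieAlg
  lie₁_eq : c.lie₁ = C.X₁.lieAlg

namespace HasLieAlgebras

variable {C : SLie2Grp.{u}} {c : SLie2Alg.{u}}

/-- The resulting identification of the underlying vector spaces of objects. -/
theorem eq₀ (h : HasLieAlgebras C c) : c.V.X₀ = C.X₀.lieAlg.toModuleCat :=
  congrArg RealLieAlg.toModuleCat h.lie₀_eq

/-- The resulting identification of the underlying vector spaces of morphisms. -/
theorem eq₁ (h : HasLieAlgebras C c) : c.V.X₁ = C.X₁.lieAlg.toModuleCat :=
  congrArg RealLieAlg.toModuleCat h.lie₁_eq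

end HasLieAlgebras

/-- In addition, the source, target and identity-assigning maps of `c` are the differentials of
those of `C`. -/
structure HasDifferentialGraph (C : SLie2Grp.{u}) (c : SLie2Alg.{u}) : Prop extends
    HasLieAlgebras C c where
  s_eq : c.V.s = eqToHom toHasLieAlgebras.eq₁ ≫ differential C.s ≫
    eqToHom toHasLieAlgebras.eq₀.symm
  t_eq : c.V.t = eqToHom toHasLieAlgebras.eq₁ ≫ differential C.t ≫
    eqToHom toHasLieAlgebras.eq₀.symm
  i_eq : c.V.i = eqToHom toHasLieAlgebras.eq₀ ≫ differential C.i ≫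
    eqToHom toHasLieAlgebras.eq₁.symm

namespace HasDifferentialGraph

variable {C : SLie2Grp.{u}} {c : SLie2Alg.{u}}

/-- The map from the Lie algebra of `C.X₁ ×_{C.X₀} C.X₁` to the pullback of the Lie algebras,
induced by the differentials of the two projections. -/
noncomputable def pairing (h : HasDifferentialGraph C c) :
    (pullback C.t C.s).lieAlg.toModuleCat ⟶ pullback c.V.t c.V.s :=
  pullback.lift (differential (pullback.fst C.t C.s) ≫ eqToHom h.eq₁.symm)
    (differential (pullback.snd C.t C.s) ≫ eqToHom h.eq₁.symm) (by
      have := congrArg differential (pullback.condition (f := C.t) (g := C.s))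
      simp only [differential_comp] at this
      rw [h.s_eq, h.t_eq]
      simp only [Category.assoc, eqToHom_trans_assoc, eqToHom_refl, Category.id_comp]
      rw [reassoc_of% this])

end HasDifferentialGraph

/-- `c` is the strict Lie 2-algebra of the strict Lie 2-group `C`: its Lie algebras of objects and
of morphisms are those of `C`, and all its structure maps are the differentials of those of `C`. -/
structure IsDifferentialObj (C : SLie2Grp.{u}) (c : SLie2Alg.{u}) : Prop extends
    HasDifferentialGraph C c where
  c_eq : toHasDifferentialGraph.pairing ≫ c.V.c =
    differential C.c ≫ eqToHom toHasDifferentialGraph.eq₁.symm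

open Bicategory in
/-- The 2-functor `d` takes strict Lie 2-groups to their strict Lie 2-algebras, strict homomorphisms
to their differentials and 2-homomorphisms to their differentials. -/
structure IsDifferentiation (d : StrictPseudofunctor SLie2Grp.{u} SLie2Alg.{u}) : Prop where
  obj : ∀ C : SLie2Grp.{u}, IsDifferentialObj C (d.obj C)
  map₀ : ∀ {C C' : SLie2Grp.{u}} (F : C ⟶ C'),
    (SLie2Alg.functor (d.map F)).F₀ = eqToHom (obj C).eq₀ ≫ differential F.F₀ ≫ eqToHom (obj C').eq₀.symm
  map₁ : ∀ {C C' : SLie2Grp.{u}} (F : C ⟶ C'),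
    (SLie2Alg.functor (d.map F)).F₁ = eqToHom (obj C).eq₁ ≫ differential F.F₁ ≫ eqToHom (obj C').eq₁.symm
  map₂ : ∀ {C C' : SLie2Grp.{u}} {F G : C ⟶ C'} (α : F ⟶ G),
    (SLie2Alg.nat (d.map₂ α)).app =
      eqToHom (obj C).eq₀ ≫ differential α.app ≫ eqToHom (obj C').eq₁.symm

/-!
Differentiation at the identity is a functor from Lie groups to Lie algebras: a homomorphism `f`
relates the invariant vector fields of `v` and of `df v`, and the Lie bracket respects related
vector fields (`VectorField.mfderiv_mlieBracket_of_related`, proved in charts from the symmetry of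
the second derivative). Applying it to a strict Lie 2-group `C` immediately gives two Lie algebras
`𝔠₀`, `𝔠₁` with `s`, `t`, `i`; what has to be understood is composition, because the pullback
`C₁ ×_{C₀} C₁` is only assumed to exist in the category of Lie groups and nothing is known in
advance about its underlying group or its Lie algebra.

Composites are written in diagrammatic order.

* In a 2-vector space, linearity forces `f ∘ g = f + g - 1_{t f}` (`TwoVect.cmp_eq`), so
  composition is determined by `s`, `t`, `i`, and conversely this formula makes every reflexive
  graph of vector spaces a 2-vector space (`TwoVect.ofGraph`).
* Points of the pullback are morphisms out of the discrete Lie group `ℤ`, so by the universal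
  property they are determined by their projections (`LieGrp.pullback_point_ext`). Hence every
  composable pair is the product `(f, 1) (1, 1)⁻¹ (1, g)`, and as composition is a homomorphism,
  `f ∘ g = f (1_{t f})⁻¹ g` in `C` (`SLie2Grp.c_apply`). Differentiating at the identity shows that
  the differential of composition is composition in the 2-vector space `𝔠`
  (`SLie2Grp.differential_c`).
* The same decomposition shows that every composable pair in `𝔠₁` is tangent to the pullback
  (`SLie2Grp.exists_lift`). Since the differentials of the projections and of composition preserve
  brackets, the bracket of `𝔠` is functorial (`SLie2Grp.bracket_comp`), and `𝔠` is a strict Lie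
  2-algebra. Functors and natural transformations are differentiated componentwise.

For uniqueness, a strict Lie 2-algebra is recovered from its two Lie algebras and from `s`, `t`, `i`
(`SLie2Alg.ext_lie`): composition is forced, and the Jacobiator is an identity. The values of `d` on
1- and 2-morphisms are prescribed by their underlying linear maps.
-/

/-! ### Lie brackets of related vector fields -/

namespace VectorField

open Set Filter Topology

variable {E E' : Type*} [NormedAddCommGroup E] [NormedSpace ℝ E]
  [NormedAddCommGroup E'] [NormedSpace ℝ E']

/-- If `F` relates `V` to `V'` and `W` to `W'` near `x`, then `dF [V, W] = [V', W']` at `x`: the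
terms with the second derivative of `F` cancel by symmetry. -/
theorem lieBracket_of_related {F : E → E'} {V W : E → E} {V' W' : E' → E'} {x : E}
    (hF : ContDiffAt ℝ 2 F x)
    (hV : DifferentiableAt ℝ V x) (hW : DifferentiableAt ℝ W x)
    (hV' : DifferentiableAt ℝ V' (F x)) (hW' : DifferentiableAt ℝ W' (F x))
    (hVV' : ∀ᶠ y in 𝓝 x, fderiv ℝ F y (V y) = V' (F y))
    (hWW' : ∀ᶠ y in 𝓝 x, fderiv ℝ F y (W y) = W' (F y)) :
    fderiv ℝ F x (lieBracket ℝ V W x) = lieBracket ℝ V' W' (F x) := by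
  have hd := hF.differentiableAt two_ne_zero
  rw [fderiv_apply_lieBracket hF (by simp) hW hV,
    EventuallyEq.fderiv_eq hVV', EventuallyEq.fderiv_eq hWW',
    fderiv_fun_comp x hW' hd, fderiv_fun_comp x hV' hd]
  simp only [ContinuousLinearMap.comp_apply, hVV'.self_of_nhds, hWW'.self_of_nhds, lieBracket]

variable {M M' : Type*}
  [TopologicalSpace M] [ChartedSpace E M] [IsManifold 𝓘(ℝ, E) 2 M]
  [TopologicalSpace M'] [ChartedSpace E' M'] [IsManifold 𝓘(ℝ, E') 2 M']

/-- A vector field read in the preferred chart at `x`. -/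
noncomputable def inChart (x : M) (V : Π y : M, TangentSpace 𝓘(ℝ, E) y) (y : E) : E :=
  mpullbackWithin 𝓘(ℝ, E) 𝓘(ℝ, E) (extChartAt 𝓘(ℝ, E) x).symm V (range 𝓘(ℝ, E)) y

theorem inChart_apply {x : M} {y : E} (hy : y ∈ (extChartAt 𝓘(ℝ, E) x).target)
    (V : Π y : M, TangentSpace 𝓘(ℝ, E) y) :
    inChart x V y = mfderiv 𝓘(ℝ, E) 𝓘(ℝ, E) (extChartAt 𝓘(ℝ, E) x)
      ((extChartAt 𝓘(ℝ, E) x).symm y) (V ((extChartAt 𝓘(ℝ, E) x).symm y)) := by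
  have : (mfderivWithin 𝓘(ℝ, E) 𝓘(ℝ, E) (extChartAt 𝓘(ℝ, E) x).symm (range 𝓘(ℝ, E)) y).inverse =
      mfderiv 𝓘(ℝ, E) 𝓘(ℝ, E) (extChartAt 𝓘(ℝ, E) x) ((extChartAt 𝓘(ℝ, E) x).symm y) :=
    ContinuousLinearMap.inverse_eq (mfderivWithin_extChartAt_symm_comp_mfderiv_extChartAt hy)
      (mfderiv_extChartAt_comp_mfderivWithin_extChartAt_symm hy)
  exact DFunLike.congr_fun this _

theorem differentiableAt_inChart [CompleteSpace E] {x : M} {V : Π y : M, TangentSpace 𝓘(ℝ, E) y}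
    (hV : MDifferentiableAt 𝓘(ℝ, E) 𝓘(ℝ, E).tangent
      (fun y => (⟨y, V y⟩ : TangentBundle 𝓘(ℝ, E) M)) x) :
    DifferentiableAt ℝ (inChart x V) (extChartAt 𝓘(ℝ, E) x x) := by
  have := (mdifferentiableWithinAt_univ.2
    hV).differentiableWithinAt_mpullbackWithin_vectorField
  rw [preimage_univ, univ_inter, ModelWithCorners.range_eq_univ] at this
  have h2 : DifferentiableAt ℝ (mpullbackWithin 𝓘(ℝ, E) 𝓘(ℝ, E) (extChartAt 𝓘(ℝ, E) x).symm V univ :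
      E → E) (extChartAt 𝓘(ℝ, E) x x) := differentiableWithinAt_univ.1 this
  unfold inChart
  rwa [ModelWithCorners.range_eq_univ]

/-- The preferred chart at `x` has the identity as its derivative at `x`, so the Lie bracket at `x`
is that of the fields read in the chart. -/
theorem mlieBracket_eq_inChart (V W : Π y : M, TangentSpace 𝓘(ℝ, E) y) (x : M) :
    mlieBracket 𝓘(ℝ, E) V W x =
      lieBracket ℝ (inChart x V) (inChart x W) (extChartAt 𝓘(ℝ, E) x x) := by
  have h : (mfderiv 𝓘(ℝ, E) 𝓘(ℝ, E) (extChartAt 𝓘(ℝ, E) x) x).inverse =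
      ContinuousLinearMap.id ℝ E := by
    rw [mfderiv_extChartAt_self]; exact ContinuousLinearMap.inverse_id
  have h2 := DFunLike.congr_fun h (lieBracketWithin ℝ (inChart x V) (inChart x W)
    ((extChartAt 𝓘(ℝ, E) x).symm ⁻¹' univ ∩ range 𝓘(ℝ, E)) (extChartAt 𝓘(ℝ, E) x x))
  refine Eq.trans ?_ (h2.trans ?_)
  · rfl
  · rw [preimage_univ, univ_inter, ModelWithCorners.range_eq_univ, lieBracketWithin_univ]
    rfl

/-- Relatedness by `f`, read in the preferred charts. -/
theorem fderiv_inChart {f : M → M'} (hf : ContMDiff 𝓘(ℝ, E) 𝓘(ℝ, E') 2 f) (x : M)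
    {V : Π y : M, TangentSpace 𝓘(ℝ, E) y} {V' : Π y : M', TangentSpace 𝓘(ℝ, E') y}
    (h : ∀ y, mfderiv 𝓘(ℝ, E) 𝓘(ℝ, E') f y (V y) = V' (f y)) :
    ∀ᶠ y in 𝓝 (extChartAt 𝓘(ℝ, E) x x),
      fderiv ℝ (writtenInExtChartAt 𝓘(ℝ, E) 𝓘(ℝ, E') x f) y (inChart x V y) =
        inChart (f x) V' (writtenInExtChartAt 𝓘(ℝ, E) 𝓘(ℝ, E') x f y) := by
  set φ := extChartAt 𝓘(ℝ, E) x
  set ψ := extChartAt 𝓘(ℝ, E') (f x)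
  have hφ : ContinuousAt φ.symm (φ x) := continuousAt_extChartAt_symm x
  have hx : φ.symm (φ x) = x := extChartAt_to_inv x
  have h2 : ∀ᶠ z in 𝓝 (φ.symm (φ x)), f z ∈ ψ.source := by
    rw [hx]
    exact hf.continuous.continuousAt (extChartAt_source_mem_nhds _)
  filter_upwards [hφ.eventually h2, extChartAt_target_mem_nhds x]
    with y hy2 hy3
  have hFy : writtenInExtChartAt 𝓘(ℝ, E) 𝓘(ℝ, E') x f y = ψ (f (φ.symm y)) := rfl
  have hback : ψ.symm (ψ (f (φ.symm y))) = f (φ.symm y) := ψ.left_inv hy2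
  rw [hFy, inChart_apply hy3, inChart_apply (ψ.map_source hy2)]
  have dψ : MDifferentiableAt 𝓘(ℝ, E') 𝓘(ℝ, E') ψ (f (φ.symm y)) :=
    mdifferentiableAt_extChartAt (by simpa [ψ] using hy2)
  have dφ' : HasMFDerivAt 𝓘(ℝ, E) 𝓘(ℝ, E) φ.symm y
      (mfderivWithin 𝓘(ℝ, E) 𝓘(ℝ, E) φ.symm (range 𝓘(ℝ, E)) y) := by
    have := (mdifferentiableWithinAt_extChartAt_symm hy3).hasMFDerivWithinAt
    rw [ModelWithCorners.range_eq_univ, hasMFDerivWithinAt_univ] at this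
    rwa [ModelWithCorners.range_eq_univ]
  let D : E →L[ℝ] E' := ((mfderiv 𝓘(ℝ, E') 𝓘(ℝ, E') ψ (f (φ.symm y))).comp
    (mfderiv 𝓘(ℝ, E) 𝓘(ℝ, E') f (φ.symm y))).comp
      (mfderivWithin 𝓘(ℝ, E) 𝓘(ℝ, E) φ.symm (range 𝓘(ℝ, E)) y)
  have hF : HasMFDerivAt 𝓘(ℝ, E) 𝓘(ℝ, E') (writtenInExtChartAt 𝓘(ℝ, E) 𝓘(ℝ, E') x f) y D :=
    (dψ.hasMFDerivAt.comp (φ.symm y) (hf.mdifferentiable two_ne_zero (φ.symm y)).hasMFDerivAt).comp y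
      dφ'
  have hF' : fderiv ℝ (writtenInExtChartAt 𝓘(ℝ, E) 𝓘(ℝ, E') x f) y = D :=
    HasFDerivAt.fderiv (HasMFDerivAt.hasFDerivAt hF :
      HasFDerivAt (𝕜 := ℝ) (E := E) (F := E') _ D y)
  refine (DFunLike.congr_fun hF' _).trans ?_
  rw [hback, ← h]
  have := DFunLike.congr_fun (mfderivWithin_extChartAt_symm_comp_mfderiv_extChartAt hy3)
    (V (φ.symm y))
  exact congrArg (fun v => mfderiv 𝓘(ℝ, E') 𝓘(ℝ, E') ψ (f (φ.symm y))
    (mfderiv 𝓘(ℝ, E) 𝓘(ℝ, E') f (φ.symm y) v)) this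

/-- The derivative of a map takes the Lie bracket of two vector fields to the Lie bracket of the
fields to which they are related; the map need not be a local diffeomorphism. -/
theorem mfderiv_mlieBracket_of_related [CompleteSpace E] [CompleteSpace E']
    {f : M → M'} (hf : ContMDiff 𝓘(ℝ, E) 𝓘(ℝ, E') 2 f) (x : M)
    {V W : Π y : M, TangentSpace 𝓘(ℝ, E) y} {V' W' : Π y : M', TangentSpace 𝓘(ℝ, E') y}
    (hV : MDifferentiableAt 𝓘(ℝ, E) 𝓘(ℝ, E).tangent
      (fun y => (⟨y, V y⟩ : TangentBundle 𝓘(ℝ, E) M)) x)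
    (hW : MDifferentiableAt 𝓘(ℝ, E) 𝓘(ℝ, E).tangent
      (fun y => (⟨y, W y⟩ : TangentBundle 𝓘(ℝ, E) M)) x)
    (hV' : MDifferentiableAt 𝓘(ℝ, E') 𝓘(ℝ, E').tangent
      (fun y => (⟨y, V' y⟩ : TangentBundle 𝓘(ℝ, E') M')) (f x))
    (hW' : MDifferentiableAt 𝓘(ℝ, E') 𝓘(ℝ, E').tangent
      (fun y => (⟨y, W' y⟩ : TangentBundle 𝓘(ℝ, E') M')) (f x))
    (hVV' : ∀ y, mfderiv 𝓘(ℝ, E) 𝓘(ℝ, E') f y (V y) = V' (f y))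
    (hWW' : ∀ y, mfderiv 𝓘(ℝ, E) 𝓘(ℝ, E') f y (W y) = W' (f y)) :
    mfderiv 𝓘(ℝ, E) 𝓘(ℝ, E') f x (mlieBracket 𝓘(ℝ, E) V W x) =
      mlieBracket 𝓘(ℝ, E') V' W' (f x) := by
  have hF0 : writtenInExtChartAt 𝓘(ℝ, E) 𝓘(ℝ, E') x f (extChartAt 𝓘(ℝ, E) x x) =
      extChartAt 𝓘(ℝ, E') (f x) (f x) := by
    simp [writtenInExtChartAt]
  have hd : (mfderiv 𝓘(ℝ, E) 𝓘(ℝ, E') f x : E →L[ℝ] E') =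
      fderiv ℝ (writtenInExtChartAt 𝓘(ℝ, E) 𝓘(ℝ, E') x f) (extChartAt 𝓘(ℝ, E) x x) := by
    have := (hf.mdifferentiable two_ne_zero x).mfderiv
    simpa using this
  have hF : ContDiffAt ℝ 2 (writtenInExtChartAt 𝓘(ℝ, E) 𝓘(ℝ, E') x f)
      (extChartAt 𝓘(ℝ, E) x x) := by
    have := (contMDiffAt_iff.1 (hf.contMDiffAt (x := x))).2
    rwa [ModelWithCorners.range_eq_univ, contDiffWithinAt_univ] at this
  have key := lieBracket_of_related hF (differentiableAt_inChart hV) (differentiableAt_inChart hW)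
    (V' := inChart (f x) V') (W' := inChart (f x) W')
    (by rw [hF0]; exact differentiableAt_inChart hV')
    (by rw [hF0]; exact differentiableAt_inChart hW')
    (fderiv_inChart hf x hVV') (fderiv_inChart hf x hWW')
  rw [hF0, ← hd] at key
  rw [mlieBracket_eq_inChart, mlieBracket_eq_inChart]
  exact key

end VectorField

/-! ### Derivatives at the identity of maps between Lie groups -/

namespace LieGrp

variable {G H K : LieGrp.{u}}

theorem map_one' (f : G ⟶ H) : f.toFun 1 = 1 := f.toMonoidHom.map_one

theorem map_mul' (f : G ⟶ H) (x y : G) : f.toFun (x * y) = f.toFun x * f.toFun y :=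
  f.toMonoidHom.map_mul x y

theorem map_inv' (f : G ⟶ H) (x : G) : f.toFun x⁻¹ = (f.toFun x)⁻¹ := f.toMonoidHom.map_inv x

theorem mdifferentiable_hom (f : G ⟶ H) : MDifferentiable 𝓘(ℝ, G.E) 𝓘(ℝ, H.E) f.toFun :=
  f.contMDiff_toFun.mdifferentiable (by simp)

/-- Invariant vector fields are related by a homomorphism to the invariant vector fields of the
images under its differential. -/
theorem mfderiv_mulInvariantVectorField (f : G ⟶ H) (v : GroupLieAlgebra 𝓘(ℝ, G.E) G) (g : G) :
    mfderiv 𝓘(ℝ, G.E) 𝓘(ℝ, H.E) f.toFun g (mulInvariantVectorField v g) =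
      mulInvariantVectorField (I := 𝓘(ℝ, H.E)) (G := H)
        (mfderiv 𝓘(ℝ, G.E) 𝓘(ℝ, H.E) f.toFun 1 v) (f.toFun g) := by
  have hG : MDifferentiableAt 𝓘(ℝ, G.E) 𝓘(ℝ, G.E) (fun x : G => g * x) 1 :=
    (contMDiff_mul_left (n := ∞)).mdifferentiable (by simp) 1
  have hH : MDifferentiableAt 𝓘(ℝ, H.E) 𝓘(ℝ, H.E) (fun x : H => f.toFun g * x) (f.toFun 1) :=
    (contMDiff_mul_left (n := ∞)).mdifferentiable (by simp) _
  have h1 := mfderiv_comp_of_eq (y := g) (mdifferentiable_hom f g) hG (mul_one g)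
  have h2 := mfderiv_comp (1 : G) hH (mdifferentiable_hom f 1)
  have e : f.toFun ∘ (fun x : G => g * x) = (fun x : H => f.toFun g * x) ∘ f.toFun :=
    funext fun x => map_mul' f g x
  rw [e, h2, mul_one, map_one'] at h1
  exact (DFunLike.congr_fun h1 v).symm

/-- The derivative at the identity of a map between Lie groups.  For a map preserving the identity
it is a map between the Lie algebras; the target tangent space is read as the one at the identity,
all tangent spaces of a manifold being copies of its model space. -/
noncomputable def derivOne (u : G → H) :
    GroupLieAlgebra 𝓘(ℝ, G.E) G →L[ℝ] GroupLieAlgebra 𝓘(ℝ, H.E) H :=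
  mfderiv 𝓘(ℝ, G.E) 𝓘(ℝ, H.E) u 1

/-- The differential of a homomorphism of Lie groups preserves brackets. -/
theorem derivOne_lie (f : G ⟶ H) (v w : GroupLieAlgebra 𝓘(ℝ, G.E) G) :
    derivOne f.toFun ⁅v, w⁆ = ⁅derivOne f.toFun v, derivOne f.toFun w⁆ := by
  have h := VectorField.mfderiv_mlieBracket_of_related (f := f.toFun) (x := 1)
    (f.contMDiff_toFun.of_le (WithTop.coe_le_coe.2 le_top))
    (mdifferentiableAt_mulInvariantVectorField v) (mdifferentiableAt_mulInvariantVectorField w)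
    (mdifferentiableAt_mulInvariantVectorField _) (mdifferentiableAt_mulInvariantVectorField _)
    (mfderiv_mulInvariantVectorField f v) (mfderiv_mulInvariantVectorField f w)
  rw [GroupLieAlgebra.bracket_def, GroupLieAlgebra.bracket_def]
  refine h.trans ?_
  rw [map_one']
  rfl

theorem mfderiv_eq_self_of_eq_id {φ : H → H} (h : φ = id) (x : H) (v : H.E) :
    (mfderiv 𝓘(ℝ, H.E) 𝓘(ℝ, H.E) φ x v : H.E) = v := by
  subst h; exact DFunLike.congr_fun mfderiv_id v

/-- The derivative of multiplication at `(1, 1)` is addition. -/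
theorem derivOne_mul {u w : G → H} (hu : MDifferentiableAt 𝓘(ℝ, G.E) 𝓘(ℝ, H.E) u 1)
    (hw : MDifferentiableAt 𝓘(ℝ, G.E) 𝓘(ℝ, H.E) w 1) (hu1 : u 1 = 1) (hw1 : w 1 = 1) :
    derivOne (fun x => u x * w x) = derivOne u + derivOne w := by
  have hm : MDifferentiableAt (𝓘(ℝ, H.E).prod 𝓘(ℝ, H.E)) 𝓘(ℝ, H.E)
      (fun p : H × H => p.1 * p.2) (u 1, w 1) :=
    (contMDiff_mul 𝓘(ℝ, H.E) ∞).mdifferentiable (by simp) _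
  have h := mfderiv_comp (1 : G) hm (hu.prodMk hw)
  ext v
  refine (DFunLike.congr_fun h v).trans ?_
  rw [ContinuousLinearMap.comp_apply, mfderiv_prod_eq_add_apply hm, mfderiv_prodMk hu hw]
  exact congrArg₂ (fun a b : H.E => a + b)
    (mfderiv_eq_self_of_eq_id (by funext z; simp [hw1]) (u 1) _)
    (mfderiv_eq_self_of_eq_id (by funext z; simp [hu1]) (w 1) _)

theorem derivOne_div {u w : G → H} (hu : ContMDiff 𝓘(ℝ, G.E) 𝓘(ℝ, H.E) ∞ u)
    (hw : ContMDiff 𝓘(ℝ, G.E) 𝓘(ℝ, H.E) ∞ w) (hu1 : u 1 = 1) (hw1 : w 1 = 1) :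
    derivOne (fun x => u x / w x) = derivOne u - derivOne w := by
  have h := derivOne_mul ((hu.div hw).mdifferentiable (by simp) 1)
    (hw.mdifferentiable (by simp) 1) (by simp [hu1, hw1]) hw1
  simp only [div_mul_cancel] at h
  exact eq_sub_of_add_eq h.symm

/-- The Lie group given by a countable group with the discrete topology. -/
noncomputable def discrete (Γ : Type u) [Group Γ] [Countable Γ] : LieGrp.{u} :=
  letI : TopologicalSpace Γ := ⊥
  haveI : DiscreteTopology Γ := ⟨rfl⟩
  letI : ChartedSpace PUnit.{u + 1} Γ := ChartedSpace.ofDiscreteTopology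
  haveI : IsManifold 𝓘(ℝ, PUnit.{u + 1}) ∞ Γ := IsManifold.of_discreteTopology ∞
  { carrier := Γ
    E := PUnit.{u + 1}
    lieGroup :=
      { contMDiff_mul := contMDiff_of_discreteTopology
        contMDiff_inv := contMDiff_of_discreteTopology } }

instance {Γ : Type u} [Group Γ] [Countable Γ] : DiscreteTopology (discrete Γ) := ⟨rfl⟩

/-- A group homomorphism from a discrete group is a morphism of Lie groups. -/
noncomputable def ofDiscrete {Γ : Type u} [Group Γ] [Countable Γ] (φ : Γ →* G) :
    discrete Γ ⟶ G where
  toFun := φ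
  map_one' := φ.map_one
  map_mul' := φ.map_mul
  contMDiff_toFun := contMDiff_of_discreteTopology (M := discrete Γ)

theorem hom_ext {f g : G ⟶ H} (h : ∀ x, f.toFun x = g.toFun x) : f = g :=
  DFunLike.coe_injective (F := ContMDiffMonoidMorphism 𝓘(ℝ, G.E) 𝓘(ℝ, H.E) ∞ G H) (funext h)

/-- Points of a pullback of Lie groups are determined by their projections: a point of a Lie group
is a morphism from the discrete group of integers. -/
theorem pullback_point_ext (f : G ⟶ K) (g : H ⟶ K) [HasPullback f g]
    {p q : (pullback f g : LieGrp.{u})}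
    (h₁ : (pullback.fst f g).toFun p = (pullback.fst f g).toFun q)
    (h₂ : (pullback.snd f g).toFun p = (pullback.snd f g).toFun q) : p = q := by
  let pt (x : (pullback f g : LieGrp.{u})) :
      discrete (ULift.{u} (Multiplicative ℤ)) ⟶ pullback f g :=
    ofDiscrete ((zpowersHom _ x).comp MulEquiv.ulift.toMonoidHom)
  have e (x : (pullback f g : LieGrp.{u})) : (pt x).toFun ⟨Multiplicative.ofAdd 1⟩ = x :=
    zpow_one x
  have hz {L : LieGrp.{u}} (k : pullback f g ⟶ L) (h : k.toFun p = k.toFun q) :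
      pt p ≫ k = pt q ≫ k := by
    have hpow (x : (pullback f g : LieGrp.{u})) (n : ULift.{u} (Multiplicative ℤ)) :
        (pt x ≫ k).toFun n = k.toFun x ^ n.down.toAdd :=
      map_zpow k.toMonoidHom x n.down.toAdd
    exact hom_ext fun n : ULift.{u} (Multiplicative ℤ) => (hpow p n).trans
      ((congrArg (· ^ n.down.toAdd) h).trans (hpow q n).symm)
  have := pullback.hom_ext (hz _ h₁) (hz _ h₂)
  rw [← e p, this, e q]

end LieGrp

/-! ### 2-vector spaces and strict Lie 2-algebras from brackets -/

namespace TwoVect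

/-- Composition in a 2-vector space is determined by its underlying reflexive graph: the pair
`(f, g)` is `(f, 1) + (1, g) - (1, 1)`, and composition is linear. -/
theorem cmp_eq (V : TwoVect.{u}) {T : ModuleCat.{u} ℝ} (f g : T ⟶ V.X₁) (h : f ≫ V.t = g ≫ V.s) :
    V.cmp f g h = f + g - f ≫ V.t ≫ V.i := by
  have e : pullback.lift f g h =
      pullback.lift f ((f ≫ V.t) ≫ V.i) (by simp [V.i_s]) +
        pullback.lift ((f ≫ V.t) ≫ V.i) g (by simp [V.i_t, h]) -
        pullback.lift ((f ≫ V.t) ≫ V.i) ((f ≫ V.t) ≫ V.i) (by simp [V.i_s, V.i_t]) := by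
    apply pullback.hom_ext <;>
      simp only [Preadditive.add_comp, Preadditive.sub_comp, pullback.lift_fst, pullback.lift_snd] <;>
      abel
  have h1 := V.cmp_id (f ≫ V.t) f (by simp [V.i_s])
  have h2 := V.id_cmp (f ≫ V.t) g (by simp [V.i_t, h])
  have h3 := V.id_cmp (f ≫ V.t) ((f ≫ V.t) ≫ V.i) (by simp [V.i_s, V.i_t])
  rw [InternalCat.cmp] at h1 h2 h3 ⊢
  rw [e, Preadditive.sub_comp, Preadditive.add_comp, h1, h2, h3, Category.assoc]

theorem c_eq (V : TwoVect.{u}) :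
    V.c = pullback.fst V.t V.s + pullback.snd V.t V.s - pullback.fst V.t V.s ≫ V.t ≫ V.i := by
  rw [← V.cmp_eq _ _ pullback.condition, InternalCat.cmp, pullback.lift_fst_snd,
    Category.id_comp]

theorem comp_c_eq (V : TwoVect.{u}) {T : ModuleCat.{u} ℝ} {p : T ⟶ pullback V.t V.s}
    {f g : T ⟶ V.X₁} (hf : p ≫ pullback.fst V.t V.s = f) (hg : p ≫ pullback.snd V.t V.s = g) :
    p ≫ V.c = f + g - f ≫ V.t ≫ V.i := by
  rw [c_eq, Preadditive.comp_sub, Preadditive.comp_add, ← Category.assoc, hf, hg]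

theorem comp_eq (V : TwoVect.{u}) (f g : V.X₁) (h : V.tgt f = V.src g) :
    V.comp f g h = f + g - V.one (V.tgt f) := by
  rw [comp, pairsComp, V.cmp_eq]
  rfl

/-- The 2-vector space on a reflexive graph of vector spaces. -/
noncomputable def ofGraph {X₀ X₁ : ModuleCat.{u} ℝ} (s t : X₁ ⟶ X₀) (i : X₀ ⟶ X₁)
    (i_s : i ≫ s = 𝟙 X₀) (i_t : i ≫ t = 𝟙 X₀) : TwoVect.{u} where
  X₀ := X₀
  X₁ := X₁
  s := s
  t := t
  i := i
  hasPullback := inferInstance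
  c := pullback.fst t s + pullback.snd t s - pullback.fst t s ≫ t ≫ i
  i_s := i_s
  i_t := i_t
  c_s := by simp [Preadditive.add_comp, Preadditive.sub_comp, i_s, pullback.condition]
  c_t := by simp [Preadditive.add_comp, Preadditive.sub_comp, i_t, pullback.condition]
  assoc f g h hfg hgh := by
    simp [Preadditive.add_comp, Preadditive.sub_comp, Preadditive.comp_add, Preadditive.comp_sub,
      pullback.lift_fst_assoc, pullback.lift_snd_assoc, pullback.lift_fst, pullback.lift_snd,
      i_t, reassoc_of% i_t]
    abel
  id_c := by
    simp [Preadditive.add_comp, Preadditive.sub_comp, Preadditive.comp_add, Preadditive.comp_sub,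
      pullback.lift_fst_assoc, pullback.lift_snd_assoc, pullback.lift_fst, pullback.lift_snd,
      i_t, reassoc_of% i_t]
  c_id := by
    simp [Preadditive.add_comp, Preadditive.sub_comp, Preadditive.comp_add, Preadditive.comp_sub,
      pullback.lift_fst_assoc, pullback.lift_snd_assoc, pullback.lift_fst, pullback.lift_snd,
      i_t, reassoc_of% i_t]

/-- A morphism of the underlying reflexive graphs of 2-vector spaces is a linear functor. -/
def ofGraphHom {V W : TwoVect.{u}} (F₀ : V.X₀ ⟶ W.X₀) (F₁ : V.X₁ ⟶ W.X₁)
    (map_s : F₁ ≫ W.s = V.s ≫ F₀) (map_t : F₁ ≫ W.t = V.t ≫ F₀)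
    (map_i : V.i ≫ F₁ = F₀ ≫ W.i) : V ⟶ W where
  F₀ := F₀
  F₁ := F₁
  map_s := map_s
  map_t := map_t
  map_i := map_i
  map_c := by
    rw [cmp_eq, c_eq, Preadditive.sub_comp, Preadditive.add_comp, Category.assoc,
      Category.assoc, Category.assoc, map_i, reassoc_of% map_t]

end TwoVect

namespace SLie2Alg

open TwoVect

/-- The strict Lie 2-algebra given by brackets on the objects and the morphisms of a 2-vector space
which are compatible with its structure maps. -/
noncomputable def ofBrackets (V : TwoVect.{u}) (b₀ : V.X₀ →ₗ[ℝ] V.X₀ →ₗ[ℝ] V.X₀)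
    (b₁ : V.X₁ →ₗ[ℝ] V.X₁ →ₗ[ℝ] V.X₁)
    (src_b : ∀ f g, V.src (b₁ f g) = b₀ (V.src f) (V.src g))
    (tgt_b : ∀ f g, V.tgt (b₁ f g) = b₀ (V.tgt f) (V.tgt g))
    (b_one : ∀ x y, b₁ (V.one x) (V.one y) = V.one (b₀ x y))
    (b_comp : ∀ (f f' g g' : V.X₁) (h : V.tgt f = V.src f') (h' : V.tgt g = V.src g'),
      b₁ (V.comp f f' h) (V.comp g g' h') =
        V.comp (b₁ f g) (b₁ f' g') (by rw [tgt_b, src_b, h, h']))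
    (skew₀ : ∀ x y, b₀ x y = -b₀ y x) (skew₁ : ∀ f g, b₁ f g = -b₁ g f)
    (jacobi₀ : ∀ x y z, b₀ (b₀ x y) z = b₀ x (b₀ y z) + b₀ (b₀ x z) y)
    (jacobi₁ : ∀ f g h, b₁ (b₁ f g) h = b₁ f (b₁ g h) + b₁ (b₁ f h) g) : SLie2Alg.{u} where
  toLie2Alg :=
    { V := V
      br₀ := b₀
      br₁ := b₁
      src_br := src_b
      tgt_br := tgt_b
      br_one := b_one
      br_comp := b_comp
      br₀_skew := skew₀
      br₁_skew := skew₁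
      J := b₀.compr₂ ((LinearMap.compRight ℝ V.one) ∘ₗ b₀)
      src_J := fun x y z => src_one _
      tgt_J := fun x y z => (tgt_one _).trans (jacobi₀ x y z)
      J_natural := fun f g h => by
        simp only [LinearMap.compr₂_apply, LinearMap.comp_apply, LinearMap.compRight_apply,
          one_comp, comp_one]
        exact jacobi₁ f g h
      J_invertible := fun x y z => by
        refine ⟨V.one (b₀ (b₀ x y) z), ?_, ?_, ?_, ?_⟩
        all_goals simp [LinearMap.compr₂_apply, LinearMap.comp_apply, LinearMap.compRight_apply]
      J_antisymm₁₂ := fun x y z => by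
        simp [arrow, LinearMap.compr₂_apply, LinearMap.comp_apply, LinearMap.compRight_apply]
      J_antisymm₂₃ := fun x y z => by
        simp [arrow, LinearMap.compr₂_apply, LinearMap.comp_apply, LinearMap.compRight_apply]
      jacobiator_identity := fun w x y z => by
        simp only [LinearMap.compr₂_apply, LinearMap.comp_apply, LinearMap.compRight_apply,
          b_one, ← map_add V.one, comp_one] }
  strict _ _ _ := rfl

end SLie2Alg

/-! ### Differentials of Lie group homomorphisms and composition in a strict Lie 2-group -/

namespace RealLieAlg

/-- The bracket of a Lie algebra, as a bilinear map. -/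
noncomputable def bracket (L : RealLieAlg.{u}) :
    L.toModuleCat →ₗ[ℝ] L.toModuleCat →ₗ[ℝ] L.toModuleCat :=
  (LinearMap.mk₂ ℝ (fun x y => ⁅x, y⁆) add_lie smul_lie lie_add (fun c x y => lie_smul c x y) :
    L.carrier →ₗ[ℝ] L.carrier →ₗ[ℝ] L.carrier)

theorem bracket_skew (L : RealLieAlg.{u}) (v w : L.toModuleCat) :
    L.bracket v w = -L.bracket w v :=
  (lie_skew (L := L.carrier) v w).symm

theorem bracket_jacobi (L : RealLieAlg.{u}) (x y z : L.toModuleCat) :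
    L.bracket (L.bracket x y) z = L.bracket x (L.bracket y z) + L.bracket (L.bracket x z) y := by
  rw [bracket_skew L (L.bracket x z) y, ← sub_eq_add_neg]
  exact lie_lie (L := L.carrier) (M := L.carrier) x y z

end RealLieAlg

namespace LieGrp

theorem differential_id (G : LieGrp.{u}) : differential (𝟙 G) = 𝟙 G.lieAlg.toModuleCat := by
  ext v
  exact DFunLike.congr_fun (mfderiv_id (I := 𝓘(ℝ, G.E)) (x := (1 : G))) v

theorem differential_bracket {G H : LieGrp.{u}} (f : G ⟶ H) (v w : G.lieAlg.toModuleCat) :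
    (differential f).hom (G.lieAlg.bracket v w) =
      H.lieAlg.bracket ((differential f).hom v) ((differential f).hom w) :=
  derivOne_lie f v w

end LieGrp

namespace SLie2Grp

open LieGrp

variable (C : SLie2Grp.{u})

/-- In a strict Lie 2-group, composition is expressed by multiplication:
`f ∘ g = f (1_{t f})⁻¹ g`, in diagrammatic order. -/
theorem c_apply (p : (pullback C.t C.s : LieGrp.{u})) :
    C.c.toFun p = (pullback.fst C.t C.s).toFun p /
      C.i.toFun (C.t.toFun ((pullback.fst C.t C.s).toFun p)) * (pullback.snd C.t C.s).toFun p := by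
  set π₁ := pullback.fst C.t C.s
  set π₂ := pullback.snd C.t C.s
  -- `l f = (f, 1)` and `r g = (1, g)`
  let l : C.X₁ ⟶ pullback C.t C.s := pullback.lift (𝟙 _) (C.t ≫ C.i) (by simp [C.i_s])
  let r : C.X₁ ⟶ pullback C.t C.s := pullback.lift (C.s ≫ C.i) (𝟙 _) (by simp [C.i_t])
  have hl₁ (x) : π₁.toFun (l.toFun x) = x :=
    congrArg (fun k : C.X₁ ⟶ C.X₁ => k.toFun x) (pullback.lift_fst _ _ _)
  have hl₂ (x) : π₂.toFun (l.toFun x) = C.i.toFun (C.t.toFun x) :=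
    congrArg (fun k : C.X₁ ⟶ C.X₁ => k.toFun x) (pullback.lift_snd _ _ _)
  have hr₁ (x) : π₁.toFun (r.toFun x) = C.i.toFun (C.s.toFun x) :=
    congrArg (fun k : C.X₁ ⟶ C.X₁ => k.toFun x) (pullback.lift_fst _ _ _)
  have hr₂ (x) : π₂.toFun (r.toFun x) = x :=
    congrArg (fun k : C.X₁ ⟶ C.X₁ => k.toFun x) (pullback.lift_snd _ _ _)
  have hcl (x) : C.c.toFun (l.toFun x) = x :=
    congrArg (fun k : C.X₁ ⟶ C.X₁ => k.toFun x) C.c_id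
  have hcr (x) : C.c.toFun (r.toFun x) = x :=
    congrArg (fun k : C.X₁ ⟶ C.X₁ => k.toFun x) C.id_c
  have hti (x) : C.t.toFun (C.i.toFun x) = x :=
    congrArg (fun k : C.X₀ ⟶ C.X₀ => k.toFun x) C.i_t
  have hst : C.t.toFun (π₁.toFun p) = C.s.toFun (π₂.toFun p) :=
    congrArg (fun k : pullback C.t C.s ⟶ C.X₀ => k.toFun p) pullback.condition
  have hp : p = l.toFun (π₁.toFun p) * (l.toFun (C.i.toFun (C.t.toFun (π₁.toFun p))))⁻¹ *
      r.toFun (π₂.toFun p) := by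
    apply pullback_point_ext
    · change π₁.toFun p = π₁.toFun _
      simp only [map_mul', map_inv', hl₁, hr₁, hst, inv_mul_cancel_right]
    · change π₂.toFun p = π₂.toFun _
      simp only [map_mul', map_inv', hl₂, hr₂, hti, mul_inv_cancel, one_mul]
  rw [hp]
  simp only [map_mul', map_inv', hcl, hcr, hl₁, hl₂, hr₁, hr₂, hti, ← hst, div_eq_mul_inv,
    mul_inv_cancel, one_mul, inv_mul_cancel_right]

/-- The derivative at the identity of `f (1_{t f})⁻¹ g`, the inverse being avoided by comparing
`f ∘ g / g` with `f / 1_{t f}`. -/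
theorem differential_c :
    differential C.c = differential (pullback.fst C.t C.s) + differential (pullback.snd C.t C.s) -
      differential (pullback.fst C.t C.s) ≫ differential C.t ≫ differential C.i := by
  have h : (fun p => C.c.toFun p / (pullback.snd C.t C.s).toFun p) = fun p =>
      (pullback.fst C.t C.s).toFun p / (pullback.fst C.t C.s ≫ C.t ≫ C.i).toFun p := by
    funext p
    rw [c_apply, mul_div_cancel_right]
    rfl
  have h2 := congrArg derivOne h
  rw [derivOne_div C.c.contMDiff_toFun (pullback.snd C.t C.s).contMDiff_toFun (map_one' _)
      (map_one' _), derivOne_div (pullback.fst C.t C.s).contMDiff_toFun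
      (pullback.fst C.t C.s ≫ C.t ≫ C.i).contMDiff_toFun (map_one' _) (map_one' _)] at h2
  rw [← differential_comp, ← differential_comp]
  have aux {A : Type u} [AddCommGroup A] {a b p q : A} (h : a - b = p - q) : a = p + b - q := by
    rw [← sub_add_cancel a b, h, sub_add_eq_add_sub]
  ext v
  exact aux (DFunLike.congr_fun h2 v)

/-- Every composable pair of elements of the Lie algebra of morphisms comes from the Lie algebra of
`C.X₁ ×_{C.X₀} C.X₁`. -/
theorem exists_lift (a b : C.X₁.lieAlg.toModuleCat)
    (h : (differential C.t).hom a = (differential C.s).hom b) :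
    ∃ v : (pullback C.t C.s).lieAlg.toModuleCat,
      (differential (pullback.fst C.t C.s)).hom v = a ∧
        (differential (pullback.snd C.t C.s)).hom v = b := by
  -- with `l f = (f, 1)` and `r g = (1, g)`, the pair `(a, b)` is `dl a - dl 1_{t a} + dr b`
  let l : C.X₁ ⟶ pullback C.t C.s := pullback.lift (𝟙 _) (C.t ≫ C.i) (by simp [C.i_s])
  let r : C.X₁ ⟶ pullback C.t C.s := pullback.lift (C.s ≫ C.i) (𝟙 _) (by simp [C.i_t])
  have hl₁ : differential l ≫ differential (pullback.fst C.t C.s) = 𝟙 _ := by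
    rw [← differential_comp, pullback.lift_fst, differential_id]
  have hl₂ : differential l ≫ differential (pullback.snd C.t C.s) =
      differential C.t ≫ differential C.i := by
    rw [← differential_comp, pullback.lift_snd, differential_comp]
  have hr₁ : differential r ≫ differential (pullback.fst C.t C.s) =
      differential C.s ≫ differential C.i := by
    rw [← differential_comp, pullback.lift_fst, differential_comp]
  have hr₂ : differential r ≫ differential (pullback.snd C.t C.s) = 𝟙 _ := by
    rw [← differential_comp, pullback.lift_snd, differential_id]
  have hit : differential C.i ≫ differential C.t = 𝟙 _ := by
    rw [← differential_comp, C.i_t, differential_id]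
  have app {A B D : ModuleCat.{u} ℝ} {f : A ⟶ B} {g : B ⟶ D} {k : A ⟶ D} (e : f ≫ g = k) (x : A) :
      g.hom (f.hom x) = k.hom x := by rw [← e]; rfl
  refine ⟨(differential l).hom (a - (differential C.i).hom ((differential C.t).hom a)) +
    (differential r).hom b, ?_, ?_⟩
  · rw [map_add, app hl₁, app hr₁]
    simp [h]
  · rw [map_add, app hl₂, app hr₂]
    simp [app hit]

end SLie2Grp

/-! ### The differentiation 2-functor -/

namespace SLie2Grp

open LieGrp TwoVect

theorem differential_cmp (C : SLie2Grp.{u}) {T : LieGrp.{u}} (f g : T ⟶ C.X₁)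
    (h : f ≫ C.t = g ≫ C.s) :
    differential (C.cmp f g h) = differential f + differential g -
      differential f ≫ differential C.t ≫ differential C.i := by
  rw [InternalCat.cmp, differential_comp, differential_c, Preadditive.comp_sub,
    Preadditive.comp_add, ← Category.assoc, ← differential_comp, ← differential_comp,
    pullback.lift_fst, pullback.lift_snd]

/-- The 2-vector space underlying the Lie 2-algebra of a strict Lie 2-group. -/
noncomputable def tangentTwoVect (C : SLie2Grp.{u}) : TwoVect.{u} :=
  TwoVect.ofGraph (differential C.s) (differential C.t) (differential C.i)
    (by rw [← differential_comp, C.i_s, differential_id])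
    (by rw [← differential_comp, C.i_t, differential_id])

theorem differential_condition (C : SLie2Grp.{u}) :
    differential (pullback.fst C.t C.s) ≫ differential C.t =
      differential (pullback.snd C.t C.s) ≫ differential C.s := by
  rw [← differential_comp, pullback.condition, differential_comp]

/-- Composition preserves brackets, since it is induced by a homomorphism of Lie groups and every
composable pair is tangent to the Lie group of composable pairs. -/
theorem bracket_comp (C : SLie2Grp.{u}) (f f' g g' : C.tangentTwoVect.X₁)
    (h : C.tangentTwoVect.tgt f = C.tangentTwoVect.src f')
    (h' : C.tangentTwoVect.tgt g = C.tangentTwoVect.src g')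
    (h'' : C.tangentTwoVect.tgt (C.X₁.lieAlg.bracket f g) =
      C.tangentTwoVect.src (C.X₁.lieAlg.bracket f' g')) :
    C.X₁.lieAlg.bracket (C.tangentTwoVect.comp f f' h) (C.tangentTwoVect.comp g g' h') =
      C.tangentTwoVect.comp (C.X₁.lieAlg.bracket f g) (C.X₁.lieAlg.bracket f' g') h'' := by
  obtain ⟨v, rfl, rfl⟩ := C.exists_lift f f' h
  obtain ⟨w, rfl, rfl⟩ := C.exists_lift g g' h'
  have hc (x : (pullback C.t C.s).lieAlg.toModuleCat) (e) :
      C.tangentTwoVect.comp ((differential (pullback.fst C.t C.s)).hom x)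
        ((differential (pullback.snd C.t C.s)).hom x) e = (differential C.c).hom x := by
    refine (comp_eq _ _ _ _).trans ?_
    rw [differential_c]
    rfl
  refine (congrArg₂ (fun a b => C.X₁.lieAlg.bracket a b) (hc v _) (hc w _)).trans ?_
  refine (differential_bracket C.c v w).symm.trans ((hc _ ?_).symm.trans
    (comp_congr (differential_bracket _ v w) (differential_bracket _ v w) _))
  exact LinearMap.congr_fun (congrArg ModuleCat.Hom.hom
    (differential_condition C)) _

/-- The strict Lie 2-algebra of a strict Lie 2-group. -/
noncomputable def lieAlg (C : SLie2Grp.{u}) : SLie2Alg.{u} :=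
  SLie2Alg.ofBrackets C.tangentTwoVect C.X₀.lieAlg.bracket C.X₁.lieAlg.bracket
    (differential_bracket C.s) (differential_bracket C.t)
    (fun x y => (differential_bracket C.i x y).symm)
    (fun f f' g g' h h' => C.bracket_comp f f' g g' h h' _)
    C.X₀.lieAlg.bracket_skew C.X₁.lieAlg.bracket_skew
    C.X₀.lieAlg.bracket_jacobi C.X₁.lieAlg.bracket_jacobi

variable {C C' C'' : SLie2Grp.{u}}

/-- The differential of a strict homomorphism of strict Lie 2-groups. -/
noncomputable def differential₁ (F : C ⟶ C') : C.lieAlg ⟶ C'.lieAlg :=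
  SLie2Alg.Hom.mk' (L := C.lieAlg) (L' := C'.lieAlg)
    (ofGraphHom (V := C.tangentTwoVect) (W := C'.tangentTwoVect)
      (differential F.F₀) (differential F.F₁)
      (by
        change _ ≫ differential C'.s = differential C.s ≫ _
        rw [← differential_comp, F.map_s, differential_comp])
      (by
        change _ ≫ differential C'.t = differential C.t ≫ _
        rw [← differential_comp, F.map_t, differential_comp])
      (by
        change differential C.i ≫ _ = _ ≫ differential C'.i
        rw [← differential_comp, F.map_i, differential_comp]))
    (differential_bracket F.F₀) (differential_bracket F.F₁)

/-- The differential of a 2-homomorphism of strict Lie 2-groups. -/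
noncomputable def differential₂ {F G : C ⟶ C'} (α : F ⟶ G) : differential₁ F ⟶ differential₁ G :=
  SLie2Alg.mkTwoHom (f := differential₁ F) (g := differential₁ G)
    { app := differential α.app
      app_s := by
        change _ ≫ differential C'.s = differential F.F₀
        rw [← differential_comp, α.app_s]
      app_t := by
        change _ ≫ differential C'.t = differential G.F₀
        rw [← differential_comp, α.app_t]
      naturality := by
        have h := congrArg differential α.naturality
        rw [differential_cmp, differential_cmp, differential_comp, differential_comp] at h
        rw [cmp_eq, cmp_eq]
        exact h }
    (differential_bracket α.app)

theorem differential₁_id (C : SLie2Grp.{u}) : differential₁ (𝟙 C) = 𝟙 C.lieAlg :=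
  SLie2Alg.Hom.ext_F (InternalCat.hom_ext (differential_id _) (differential_id _))

theorem differential₁_comp (F : C ⟶ C') (G : C' ⟶ C'') :
    differential₁ (F ≫ G) = differential₁ F ≫ differential₁ G :=
  SLie2Alg.Hom.ext_F (InternalCat.hom_ext (differential_comp _ _) (differential_comp _ _))

theorem differential₂_id (F : C ⟶ C') : differential₂ (𝟙 F) = 𝟙 (differential₁ F) :=
  SLie2Alg.hom₂_ext (InternalCat.hom₂_ext (differential_comp F.F₀ C'.i))

theorem differential₂_comp {F G H : C ⟶ C'} (α : F ⟶ G) (β : G ⟶ H) :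
    differential₂ (α ≫ β) = differential₂ α ≫ differential₂ β :=
  SLie2Alg.hom₂_ext (InternalCat.hom₂_ext ((differential_cmp C' α.app β.app _).trans
    (cmp_eq C'.tangentTwoVect (differential α.app) (differential β.app) _).symm))

/-- Identity 2-homomorphisms coming from equalities of homomorphisms do not change the underlying
linear map. -/
theorem _root_.SLie2Alg.conj_eqToHom_app {L L' : SLie2Alg.{u}} {f f' g g' : L ⟶ L'} (e : f = f')
    (θ : f' ⟶ g') (e' : g' = g) :
    (SLie2Alg.nat (eqToHom e ≫ θ ≫ eqToHom e')).app = (SLie2Alg.nat θ).app := by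
  subst e e'
  rw [eqToHom_refl, eqToHom_refl, Category.id_comp, Category.comp_id]

open Bicategory

theorem differential₂_whiskerLeft (F : C ⟶ C') {G H : C' ⟶ C''} (α : G ⟶ H) :
    differential₂ (F ◁ α) = eqToHom (differential₁_comp F G) ≫
      (differential₁ F ◁ differential₂ α) ≫ eqToHom (differential₁_comp F H).symm :=
  SLie2Alg.hom₂_ext (InternalCat.hom₂_ext
    ((differential_comp F.F₀ α.app).trans (SLie2Alg.conj_eqToHom_app (differential₁_comp F G)
      (differential₁ F ◁ differential₂ α) (differential₁_comp F H).symm).symm))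

theorem differential₂_whiskerRight {F G : C ⟶ C'} (α : F ⟶ G) (H : C' ⟶ C'') :
    differential₂ (α ▷ H) = eqToHom (differential₁_comp F H) ≫
      (differential₂ α ▷ differential₁ H) ≫ eqToHom (differential₁_comp G H).symm :=
  SLie2Alg.hom₂_ext (InternalCat.hom₂_ext
    ((differential_comp α.app H.F₁).trans (SLie2Alg.conj_eqToHom_app (differential₁_comp F H)
      (differential₂ α ▷ differential₁ H) (differential₁_comp G H).symm).symm))

/-- Differentiation of strict Lie 2-groups, strict homomorphisms and 2-homomorphisms. -/
noncomputable def differentiation : StrictPseudofunctor SLie2Grp.{u} SLie2Alg.{u} :=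
  StrictPseudofunctor.mk''
    { obj := lieAlg
      map := differential₁
      map₂ := differential₂
      map₂_id := differential₂_id
      map₂_comp := differential₂_comp
      map_id := differential₁_id
      map_comp := differential₁_comp
      map₂_whisker_left := differential₂_whiskerLeft
      map₂_whisker_right := differential₂_whiskerRight }

theorem eq_eqToHom_conj {X Y : ModuleCat.{u} ℝ} (f : X ⟶ Y) :
    f = eqToHom rfl ≫ f ≫ eqToHom rfl := by
  rw [eqToHom_refl, eqToHom_refl, Category.id_comp, Category.comp_id]

theorem hasDifferentialGraph_lieAlg (C : SLie2Grp.{u}) : HasDifferentialGraph C C.lieAlg where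
  lie₀_eq := rfl
  lie₁_eq := rfl
  s_eq := eq_eqToHom_conj (differential C.s)
  t_eq := eq_eqToHom_conj (differential C.t)
  i_eq := eq_eqToHom_conj (differential C.i)

theorem isDifferentialObj_lieAlg (C : SLie2Grp.{u}) : IsDifferentialObj C C.lieAlg where
  toHasDifferentialGraph := hasDifferentialGraph_lieAlg C
  c_eq := by
    refine (comp_c_eq C.tangentTwoVect (p := (hasDifferentialGraph_lieAlg C).pairing)
      ((pullback.lift_fst _ _ _).trans (Category.comp_id _))
      ((pullback.lift_snd _ _ _).trans (Category.comp_id _))).trans ?_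
    exact C.differential_c.symm.trans (Category.comp_id _).symm

theorem isDifferentiation_differentiation : IsDifferentiation differentiation.{u} where
  obj := isDifferentialObj_lieAlg
  map₀ F := eq_eqToHom_conj (differential F.F₀)
  map₁ F := eq_eqToHom_conj (differential F.F₁)
  map₂ α := eq_eqToHom_conj (differential α.app)

end SLie2Grp

/-! ### Uniqueness -/

/-- A real Lie algebra as a vector space with a bilinear map. -/
noncomputable def RealLieAlg.toSigma (L : RealLieAlg.{u}) :
    Σ M : ModuleCat.{u} ℝ, M →ₗ[ℝ] M →ₗ[ℝ] M :=
  ⟨L.toModuleCat, L.bracket⟩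

/-- A 2-vector space is determined by its underlying reflexive graph. -/
theorem TwoVect.ext_graph {V W : TwoVect.{u}} (h₀ : V.X₀ = W.X₀) (h₁ : V.X₁ = W.X₁)
    (hs : HEq V.s W.s) (ht : HEq V.t W.t) (hi : HEq V.i W.i) : V = W := by
  have hV := V.c_eq
  have hW := W.c_eq
  obtain ⟨X₀, X₁, s, t, i, hp, c, _, _, _, _, _, _, _⟩ := V
  obtain ⟨X₀', X₁', s', t', i', hp', c', _, _, _, _, _, _, _⟩ := W
  cases h₀; cases h₁; cases hs; cases ht; cases hi
  obtain rfl : c = c' := hV.trans hW.symm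
  rfl

namespace SLie2Alg

/-- A strict Lie 2-algebra is determined by its Lie algebras of objects and of morphisms and its
source, target and identity-assigning maps. -/
theorem ext_lie {L L' : SLie2Alg.{u}} (h₀ : L.lie₀ = L'.lie₀) (h₁ : L.lie₁ = L'.lie₁)
    (hs : HEq L.V.s L'.V.s) (ht : HEq L.V.t L'.V.t) (hi : HEq L.V.i L'.V.i) : L = L' := by
  have e₀ := Sigma.mk.inj (congrArg RealLieAlg.toSigma h₀)
  have e₁ := Sigma.mk.inj (congrArg RealLieAlg.toSigma h₁)
  have eV : L.V = L'.V := TwoVect.ext_graph e₀.1 e₁.1 hs ht hi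
  obtain ⟨⟨V, b₀, b₁, _, _, _, _, _, _, J, _, _, _, _, _, _, _⟩, hL⟩ := L
  obtain ⟨⟨V', b₀', b₁', _, _, _, _, _, _, J', _, _, _, _, _, _, _⟩, hL'⟩ := L'
  cases eV
  obtain rfl : b₀ = b₀' := eq_of_heq e₀.2
  obtain rfl : b₁ = b₁' := eq_of_heq e₁.2
  obtain rfl : J = J' := by
    ext x y z
    exact (hL x y z).trans (hL' x y z).symm
  rfl

end SLie2Alg

theorem IsDifferentialObj.unique {C : SLie2Grp.{u}} {c c' : SLie2Alg.{u}}
    (h : IsDifferentialObj C c) (h' : IsDifferentialObj C c') : c = c' := by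
  have conj {A A' B B' M N : ModuleCat.{u} ℝ} (a : A = M) (a' : A' = M) (b : N = B) (b' : N = B')
      (f : M ⟶ N) : HEq (eqToHom a ≫ f ≫ eqToHom b) (eqToHom a' ≫ f ≫ eqToHom b') := by
    subst a a' b b'; rfl
  refine SLie2Alg.ext_lie (h.lie₀_eq.trans h'.lie₀_eq.symm) (h.lie₁_eq.trans h'.lie₁_eq.symm)
    ?_ ?_ ?_
  · rw [h.s_eq, h'.s_eq]; exact conj _ _ _ _ _
  · rw [h.t_eq, h'.t_eq]; exact conj _ _ _ _ _
  · rw [h.i_eq, h'.i_eq]; exact conj _ _ _ _ _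

namespace CategoryTheory.StrictPseudofunctor
universe w₁ v₁ u₁ w₂ v₂ u₂

variable {B : Type u₁} [Bicategory.{w₁, v₁} B] {D : Type u₂} [Bicategory.{w₂, v₂} D]

/-- The structure 2-isomorphisms of a strict pseudofunctor carry no data. -/
theorem ext_prelax {F G : StrictPseudofunctor B D}
    (h : F.toPrelaxFunctor = G.toPrelaxFunctor) : F = G := by
  obtain ⟨⟨⟨P, mapId, mapComp, _, _, _, _, _⟩, map_id, hid⟩, map_comp, hcomp⟩ := F
  obtain ⟨⟨⟨P', mapId', mapComp', _, _, _, _, _⟩, map_id', hid'⟩, map_comp', hcomp'⟩ := G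
  cases h
  obtain rfl : @mapId = @mapId' := by
    funext a
    exact (hid a).trans (hid' a).symm
  obtain rfl : @mapComp = @mapComp' := by
    funext a b c f g
    exact (hcomp f g).trans (hcomp' f g).symm
  rfl

end CategoryTheory.StrictPseudofunctor

theorem IsDifferentiation.unique {d d' : StrictPseudofunctor SLie2Grp.{u} SLie2Alg.{u}}
    (h : IsDifferentiation d) (h' : IsDifferentiation d') : d = d' := by
  obtain ⟨⟨⟨⟨⟨⟨obj, map⟩, map₂⟩, _, _⟩, _, _, _, _, _, _, _⟩, _, _⟩, _, _⟩ := d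
  obtain ⟨⟨⟨⟨⟨⟨obj', map'⟩, map₂'⟩, _, _⟩, _, _, _, _, _, _, _⟩, _, _⟩, _, _⟩ := d'
  refine StrictPseudofunctor.ext_prelax ?_
  have h₀ : ∀ C, IsDifferentialObj C (obj C) := h.obj
  have h₀' : ∀ C, IsDifferentialObj C (obj' C) := h'.obj
  obtain rfl : obj = obj' := funext fun C => (h₀ C).unique (h₀' C)
  obtain rfl : @map = @map' := by
    funext C C' F
    exact SLie2Alg.Hom.ext_F (InternalCat.hom_ext ((h.map₀ F).trans (h'.map₀ F).symm)
      ((h.map₁ F).trans (h'.map₁ F).symm))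
  obtain rfl : @map₂ = @map₂' := by
    funext C C' F G α
    exact SLie2Alg.hom₂_ext (InternalCat.hom₂_ext ((h.map₂ α).trans (h'.map₂ α).symm))
  rfl

theorem mainTheorem11 :
    ∃! d : StrictPseudofunctor SLie2Grp.{u} SLie2Alg.{u}, IsDifferentiation d :=
  ⟨SLie2Grp.differentiation, SLie2Grp.isDifferentiation_differentiation,
    fun _ h => h.unique SLie2Grp.isDifferentiation_differentiation⟩
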